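/- Let $\mathcal A,\mathcal S,\mathcal X,\mathcal Y,\mathcal Z$ be finite alphabets, $Q_{S|A}$ a state law controlled by actions, $W_{YZ|XS}$ a memoryless channel law ($Y$ is the receiver's output, $Z$ the warden's), $a_0\in\mathcal A$ and $x_0\in\mathcal X$ innocent symbols, and $Q_0(z)=\sum_{s,y}Q_{S|A}(s|a_0)W_{YZ|XS}(y,z|x_0,s)$. A code of length $N$ and rate $R\ge 0$ has a uniform message $M\in\{1,\dots,\lfloor 2^{NR}\rfloor\}$ and an independent uniform key $K$ in a finite nonempty set $\mathcal K_N$, shared by the transmitter and the receiver. A stochastic action encoder produces $A_t$ from $(M,K,A^{t-1})$, $t\le N$. The states $S_t$ are then drawn independently from $Q_{S|A}(\cdot|A_t)$. A stochastic encoder with non-causal access to the states produces $X_t$ from $(M,K,A^N,S^N,X^{t-1})$. The outputs $(Y_t,Z_t)$ are drawn independently from $W_{YZ|XS}(\cdot|X_t,S_t)$, and the receiver forms an estimate $\hat M$ of $M$ (or declares an error) from $(Y^N,K)$. The rate $R$ is achievable if there are such codes for $N=0,1,2,\dots$ with $\frac1N\log_2|\mathcal K_N|\to0$, $\mathbb P(\hat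 M\neq M)\to0$ and $\mathbb D(P_{Z^N}\,\|\,Q_0^{\otimes N})\to0$ as $N\to\infty$. The covert capacity $\mathrm C_{\text{AD-NC}}$ is the supremum of the achievable rates. All information quantities are in bits. Let $\mathcal G$ be the set of joint probability mass functions $P_{ASUVXYZ}$ of the form $$P_{ASUVXYZ}=P_A\,Q_{S|A}\,P_{U|AS}\,P_{V|US}\,P_{X|US}\,W_{YZ|XS}$$ with $P_Z=Q_0$, $|\mathcal U|\le|\mathcal A||\mathcal S||\mathcal X|+4$, $|\mathcal V|\le(|\mathcal A||\mathcal S||\mathcal X|+4)^2$, such that each of the three numbers $$I(U;Y)-I(U;S|A),\qquad I(U,V;Y)-I(U;S|V,A),\qquad I(V;A,U,Y)$$ is at least $I(V;Z)-I(V;S)$. Let $\mathcal F$ be the set of all $R\ge0$ for which there is $P_{ASUVXYZ}\in\mathcal G$ with $$R\le\min\{I(U;Y)-I(U;S|A),\ I(U,V;Y)-I(U;S|V,A),\ I(V;A,U,Y)\}.$$ Then $\mathrm C_{\text{AD-NC}}\le\sup\mathcal F$. -/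

import Mathlib

namespace CovertADSI

/-! ### Probability mass functions on finite alphabets, and information measures in bits

A probability mass function on a finite alphabet `α` is an element of `stdSimplex ℝ α`; a random
variable on a finite probability space `(Ω, p)` is a function on `Ω`. -/

section Information

variable {Ω α β γ : Type*} [Fintype Ω]

open Classical in
/-- The probability mass function of the random variable `f` under `p`. -/
noncomputable def law (p : Ω → ℝ) (f : Ω → α) (b : α) : ℝ :=
  ∑ ω, if f ω = b then p ω else 0

/-- The Shannon entropy `H(f)` of the random variable `f` under `p`, in bits. -/
noncomputable def entropy [Fintype α] (p : Ω → ℝ) (f : Ω → α) : ℝ :=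
  (∑ b, Real.negMulLog (law p f b)) / Real.log 2

/-- The mutual information `I(f; g) = H(f) + H(g) - H(f, g)`, in bits. -/
noncomputable def mutualInfo [Fintype α] [Fintype β] (p : Ω → ℝ) (f : Ω → α) (g : Ω → β) : ℝ :=
  entropy p f + entropy p g - entropy p (fun ω => (f ω, g ω))

/-- The conditional mutual information
`I(f; g | h) = H(f, h) + H(g, h) - H(f, g, h) - H(h)`, in bits. -/
noncomputable def condMutualInfo [Fintype α] [Fintype β] [Fintype γ]
    (p : Ω → ℝ) (f : Ω → α) (g : Ω → β) (h : Ω → γ) : ℝ :=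
  entropy p (fun ω => (f ω, h ω)) + entropy p (fun ω => (g ω, h ω))
    - entropy p (fun ω => (f ω, g ω, h ω)) - entropy p h

open Classical in
/-- The Kullback-Leibler divergence `D(P || Q) = ∑ P log₂ (P / Q)`; it is `⊤` when `P` is not
absolutely continuous with respect to `Q`. -/
noncomputable def klDivergence [Fintype α] (P Q : α → ℝ) : EReal :=
  if ∀ x, Q x = 0 → P x = 0 then ((∑ x, P x * Real.logb 2 (P x / Q x) : ℝ) : EReal) else ⊤

end Information

/-! ### The channel, codes, and the covert capacity -/

/-- A discrete memoryless channel with action-dependent states: the state law `Q_{S|A}`, the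
channel law `W_{YZ|XS}`, and the innocent symbols of the action and of the channel input. -/
structure ActionChannel (A S X Y Z : Type*) [Fintype S] [Fintype Y] [Fintype Z] where
  /-- `Q a s` is `Q_{S|A}(s|a)`. -/
  Q : A → S → ℝ
  Q_mem : ∀ a, Q a ∈ stdSimplex ℝ S
  /-- `W x s (y, z)` is `W_{YZ|XS}(y,z|x,s)`. -/
  W : X → S → Y × Z → ℝ
  W_mem : ∀ x s, W x s ∈ stdSimplex ℝ (Y × Z)
  /-- the innocent action symbol -/
  a₀ : A
  /-- the innocent channel input symbol -/
  x₀ : X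

/-- The first `t` symbols of a sequence of length `N`. -/
def past {N : ℕ} {α : Type*} (w : Fin N → α) (t : Fin N) : Fin (t : ℕ) → α :=
  fun i => w (Fin.castLE t.is_lt.le i)

/-- A code with `M` messages and block length `N`, the states being available non-causally at the
encoder. The two stochastic encoders (deterministic maps that use local randomness) are given by
the conditional probability mass functions of their outputs:
`actionEnc m k t a^{t-1}` is that of the action `a_t`, and `inputEnc m k a^N s^N t x^{t-1}` is that
of the channel input `x_t`. The value `none` of the decoder is the error symbol. -/
structure Code (A S X Y : Type*) [Fintype A] [Fintype X] (M N : ℕ) where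
  /-- the number of values of the shared secret key -/
  keyCard : ℕ
  keyCard_pos : 0 < keyCard
  actionEnc : Fin M → Fin keyCard → (t : Fin N) → (Fin (t : ℕ) → A) → A → ℝ
  actionEnc_mem : ∀ m k t w, actionEnc m k t w ∈ stdSimplex ℝ A
  inputEnc : Fin M → Fin keyCard → (Fin N → A) → (Fin N → S) →
    (t : Fin N) → (Fin (t : ℕ) → X) → X → ℝ
  inputEnc_mem : ∀ m k a s t w, inputEnc m k a s t w ∈ stdSimplex ℝ X
  decode : (Fin N → Y) → Fin keyCard → Option (Fin M)

section Coding

variable {A S X Y Z : Type*} [Fintype A] [Fintype S] [Fintype X] [Fintype Y] [Fintype Z]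

/-- The distribution `Q₀` at the warden's output when no communication takes place. -/
noncomputable def ActionChannel.Q₀ (ch : ActionChannel A S X Y Z) (z : Z) : ℝ :=
  ∑ s, ch.Q ch.a₀ s * ∑ y, ch.W ch.x₀ s (y, z)

/-- The joint probability mass function of `(M, K, A^N, S^N, X^N, Y^N, Z^N)` that a code induces;
the message and the key are uniform and independent. -/
noncomputable def Code.joint {M N : ℕ} (C : Code A S X Y M N) (ch : ActionChannel A S X Y Z) :
    Fin M × Fin C.keyCard × (Fin N → A) × (Fin N → S) × (Fin N → X) × (Fin N → Y) × (Fin N → Z)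
      → ℝ :=
  fun (m, k, a, s, x, y, z) =>
    (1 / (M : ℝ)) * (1 / (C.keyCard : ℝ))
      * (∏ t, C.actionEnc m k t (past a t) (a t))
      * (∏ t, ch.Q (a t) (s t))
      * (∏ t, C.inputEnc m k a s t (past x t) (x t))
      * (∏ t, ch.W (x t) (s t) (y t, z t))

/-- The probability of error `P(M̂ ≠ M)`. -/
noncomputable def Code.errorProb {M N : ℕ} (C : Code A S X Y M N)
    (ch : ActionChannel A S X Y Z) : ℝ :=
  ∑ m, ∑ k, ∑ a, ∑ s, ∑ x, ∑ y, ∑ z,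
    if C.decode y k = some m then 0 else C.joint ch (m, k, a, s, x, y, z)

/-- The distribution `P_{Z^N}` that a code induces at the warden's output. -/
noncomputable def Code.wardenLaw {M N : ℕ} (C : Code A S X Y M N)
    (ch : ActionChannel A S X Y Z) (z : Fin N → Z) : ℝ :=
  ∑ m, ∑ k, ∑ a, ∑ s, ∑ x, ∑ y, C.joint ch (m, k, a, s, x, y, z)

/-- `R ≥ 0` is an achievable covert rate: there are codes with `⌊2^{NR}⌋` messages, with a shared
secret key of negligible rate, with vanishing probability of error, and with
`D(P_{Z^N} || Q₀^{⊗N}) → 0`. -/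
def CovertAchievable (ch : ActionChannel A S X Y Z) (R : ℝ) : Prop :=
  0 ≤ R ∧ ∃ C : (N : ℕ) → Code A S X Y ⌊(2 : ℝ) ^ ((N : ℝ) * R)⌋₊ N,
    Filter.Tendsto (fun N : ℕ => Real.logb 2 ((C N).keyCard : ℝ) / (N : ℝ))
      Filter.atTop (nhds 0) ∧
    Filter.Tendsto (fun N : ℕ => (C N).errorProb ch) Filter.atTop (nhds 0) ∧
    Filter.Tendsto
      (fun N : ℕ => klDivergence ((C N).wardenLaw ch) (fun z => ∏ t, ch.Q₀ (z t)))
      Filter.atTop (nhds 0)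

/-- The covert capacity with non-causal state information at the encoder: the supremum, in the
extended reals, of the achievable covert rates. -/
noncomputable def covertCapacity (ch : ActionChannel A S X Y Z) : EReal :=
  ⨆ R ∈ {R : ℝ | CovertAchievable ch R}, (R : EReal)

end Coding

/-! ### The single-letter upper bound -/

section SingleLetter

/-- The sample space of `(A, S, U, V, X, Y, Z)`, with its coordinate random variables. -/
abbrev Sample (A S U V X Y Z : Type*) := A × S × U × V × X × Y × Z

namespace Sample

variable {A S U V X Y Z : Type*}

abbrev rvA (w : Sample A S U V X Y Z) : A := w.1

abbrev rvS (w : Sample A S U V X Y Z) : S := w.2.1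

abbrev rvU (w : Sample A S U V X Y Z) : U := w.2.2.1

abbrev rvV (w : Sample A S U V X Y Z) : V := w.2.2.2.1

abbrev rvX (w : Sample A S U V X Y Z) : X := w.2.2.2.2.1

abbrev rvY (w : Sample A S U V X Y Z) : Y := w.2.2.2.2.2.1

abbrev rvZ (w : Sample A S U V X Y Z) : Z := w.2.2.2.2.2.2

end Sample

variable {A S U V X Y Z : Type*} [Fintype A] [Fintype S] [Fintype U] [Fintype V] [Fintype X]
  [Fintype Y] [Fintype Z]

/-- `P_{ASUVXYZ} = P_A Q_{S|A} P_{U|AS} P_{V|US} P_{X|US} W_{YZ|XS}` for some probability mass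
functions `P_A`, `P_{U|AS}`, `P_{V|US}` and `P_{X|US}`. -/
def Factorizes (ch : ActionChannel A S X Y Z) (P : Sample A S U V X Y Z → ℝ) : Prop :=
  ∃ (PA : A → ℝ) (PU : A → S → U → ℝ) (PV : U → S → V → ℝ) (PX : U → S → X → ℝ),
    PA ∈ stdSimplex ℝ A ∧
    (∀ a s, PU a s ∈ stdSimplex ℝ U) ∧
    (∀ u s, PV u s ∈ stdSimplex ℝ V) ∧
    (∀ u s, PX u s ∈ stdSimplex ℝ X) ∧
    ∀ a s u v x y z,
      P (a, s, u, v, x, y, z) =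
        PA a * ch.Q a s * PU a s u * PV u s v * PX u s x * ch.W x s (y, z)

open Sample

/-- `I(U;Y) - I(U;S|A)` -/
noncomputable def rate₁ (P : Sample A S U V X Y Z → ℝ) : ℝ :=
  mutualInfo P rvU rvY - condMutualInfo P rvU rvS rvA

/-- `I(U,V;Y) - I(U;S|V,A)` -/
noncomputable def rate₂ (P : Sample A S U V X Y Z → ℝ) : ℝ :=
  mutualInfo P (fun w => (rvU w, rvV w)) rvY
    - condMutualInfo P rvU rvS (fun w => (rvV w, rvA w))

/-- `I(V;A,U,Y)` -/
noncomputable def rate₃ (P : Sample A S U V X Y Z → ℝ) : ℝ :=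
  mutualInfo P rvV (fun w => (rvA w, rvU w, rvY w))

/-- `I(V;Z) - I(V;S)` -/
noncomputable def resolvability (P : Sample A S U V X Y Z → ℝ) : ℝ :=
  mutualInfo P rvV rvZ - mutualInfo P rvV rvS

/-- The constraints on the joint distribution `P_{ASUVXYZ}`, apart from the cardinality bounds. -/
structure Admissible (ch : ActionChannel A S X Y Z) (P : Sample A S U V X Y Z → ℝ) : Prop where
  factorizes : Factorizes ch P
  rate₁_ge : resolvability P ≤ rate₁ P
  rate₂_ge : resolvability P ≤ rate₂ P
  rate₃_ge : resolvability P ≤ rate₃ P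
  warden : law P rvZ = ch.Q₀

/-- The set of the rates `R ≥ 0` below the three bounds, for an admissible joint distribution with
`|U| ≤ |A||S||X| + 4` and `|V| ≤ (|A||S||X| + 4)²`. -/
def upperRegion (ch : ActionChannel A S X Y Z) : Set ℝ :=
  {R | 0 ≤ R ∧ ∃ nU nV : ℕ,
    nU ≤ Fintype.card A * Fintype.card S * Fintype.card X + 4 ∧
    nV ≤ (Fintype.card A * Fintype.card S * Fintype.card X + 4) ^ 2 ∧
    ∃ P : Sample A S (Fin nU) (Fin nV) X Y Z → ℝ,
      Admissible ch P ∧ R ≤ rate₁ P ∧ R ≤ rate₂ P ∧ R ≤ rate₃ P}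

end SingleLetter

end CovertADSI

/-!
Call an auxiliary variable `U` that determines the action `A`, with `X` produced from `(U, S)`, a
mixture: it is a convex combination of laws of `(A, S, X)` with a deterministic action. For a mixture
in which `S` has the conditional law `Q` given `A`,

`I(U;Y) - I(U;S|A) = H(Y) - ∑ a, P(A = a) H(Q_a) + ∑ u, P(U = u) (H(S|U = u) - H(Y|U = u))`,

so that this rate is a function `mixtureRate` of a point `c` of the convex hull of the compact set
`letterSet` of the pairs (law of `(A, S, X)`, `H(S) - H(Y)`).

*Converse.* For a code let `U_t = (M, K, A^N, Y^{t-1}, S_{t+1}^N)`. The sum of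
`H(S_t|U_t) - H(Y_t|U_t)` telescopes (Csiszár's sum identity) to
`H(S^N|M,K,A^N) - H(Y^N|M,K,A^N)`, and the first term is the sum of the `H(S_t|A_t)` because the
states are memoryless given the actions. With Fano's inequality (`sum_letters_ge`), the time average
of the letters is a point of the convex hull whose `mixtureRate` is at least the rate of the code, up
to a vanishing term (`exists_mixture_of_code`). The time-averaged law of the warden's letters tends
to `Q₀`, since the divergence bounds the total variation of the block (`sq_sum_abs_sub_le`) and hence
of each letter. The convex hull is compact, so a limit point has the warden's law `Q₀` and a rate at
least `R` (`exists_mixture_of_achievable`), and by Carathéodory's theorem it is a mixture of at most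
`|A||S||X| + 2` atoms.

*The variable `V`.* Any `V` produced from `U` alone satisfies
`I(V;Z) - I(V;S) ≤ I(V;U) = I(V;A,U,Y)` and
`I(U;Y) - I(U;S|A) ≤ I(U,V;Y) - I(U;S|V,A)`. All constraints therefore hold with the minimum
`I(U;Y) - I(U;S|A)` once `I(V;U)` equals this number, which lies between `0` and `H(U)`. An erasure
channel from `U` to `V` with a suitable erasure probability does this (`mem_upperRegion_of_mixture`),
and it adds only one symbol to the alphabet of `V`.
-/

namespace CovertADSI

/-! ### Laws and entropies of random variables -/

section InformationMeasures

variable {Ω α β γ : Type*} [Fintype Ω] {p : Ω → ℝ}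

/-- The Shannon entropy, in bits, of a probability mass function. -/
noncomputable def shannon [Fintype α] (q : α → ℝ) : ℝ :=
  (∑ b, Real.negMulLog (q b)) / Real.log 2

lemma entropy_eq_shannon [Fintype α] (p : Ω → ℝ) (f : Ω → α) :
    entropy p f = shannon (law p f) := rfl

lemma law_apply [DecidableEq α] (p : Ω → ℝ) (f : Ω → α) (b : α) :
    law p f b = ∑ ω, if f ω = b then p ω else 0 := by
  unfold law
  congr!

lemma law_nonneg (hp : ∀ ω, 0 ≤ p ω) (f : Ω → α) (b : α) : 0 ≤ law p f b :=
  Finset.sum_nonneg fun ω _ => by split_ifs <;> simp [hp]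

lemma le_law (hp : ∀ ω, 0 ≤ p ω) (f : Ω → α) (ω : Ω) : p ω ≤ law p f (f ω) := by
  classical
  have := Finset.single_le_sum (f := fun ω' => if f ω' = f ω then p ω' else 0)
    (fun ω' _ => by split_ifs <;> simp [hp]) (Finset.mem_univ ω)
  simpa [law] using this

/-- The expectation of a function of `f` is the expectation under the law of `f`. -/
lemma sum_law_mul [Fintype α] (p : Ω → ℝ) (f : Ω → α) (F : α → ℝ) :
    ∑ b, law p f b * F b = ∑ ω, p ω * F (f ω) := by
  classical
  simp only [law, Finset.sum_mul, ite_mul, zero_mul]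
  rw [Finset.sum_comm]
  simp

lemma sum_law [Fintype α] (p : Ω → ℝ) (f : Ω → α) : ∑ b, law p f b = ∑ ω, p ω := by
  simpa using sum_law_mul p f 1

lemma law_comp [Fintype α] (p : Ω → ℝ) (f : Ω → α) (φ : α → β) (c : β) :
    law p (fun ω => φ (f ω)) c = law (law p f) φ c := by
  classical
  have := sum_law_mul p f (fun b => if φ b = c then 1 else 0)
  simp only [mul_ite, mul_one, mul_zero] at this
  simp only [law] at this ⊢
  convert this.symm

lemma sum_law_prod_right [Fintype β] (p : Ω → ℝ) (f : Ω → α) (g : Ω → β) (a : α) :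
    ∑ b, law p (fun ω => (f ω, g ω)) (a, b) = law p f a := by
  classical
  simp only [law, Prod.mk.injEq, ite_and]
  rw [Finset.sum_comm]
  refine Finset.sum_congr rfl fun ω _ => ?_
  split_ifs <;> simp

lemma sum_law_prod_left [Fintype α] (p : Ω → ℝ) (f : Ω → α) (g : Ω → β) (b : β) :
    ∑ a, law p (fun ω => (f ω, g ω)) (a, b) = law p g b := by
  classical
  simp only [law, Prod.mk.injEq]
  rw [Finset.sum_comm]
  refine Finset.sum_congr rfl fun ω _ => ?_
  by_cases h : g ω = b <;> simp [h]

lemma law_prod_le (hp : ∀ ω, 0 ≤ p ω) (f : Ω → α) (g : Ω → β) (a : α) (b : β) :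
    law p (fun ω => (f ω, g ω)) (a, b) ≤ law p f a := by
  classical
  refine Finset.sum_le_sum fun ω _ => ?_
  by_cases h : f ω = a <;> by_cases h' : g ω = b <;> simp [h, h', hp]

lemma law_prod_eq_mul_div (hp : ∀ ω, 0 ≤ p ω) (f : Ω → α) (g : Ω → β) (a : α) (b : β) :
    law p (fun ω => (f ω, g ω)) (a, b)
      = law p f a * (law p (fun ω => (f ω, g ω)) (a, b) / law p f a) := by
  by_cases h : law p f a = 0
  · have h1 := law_prod_le hp f g a b
    have h2 := law_nonneg hp (fun ω => (f ω, g ω)) (a, b)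
    rw [h] at h1 ⊢
    simp [le_antisymm h1 h2]
  · field_simp

lemma entropy_eq_sum [Fintype α] (p : Ω → ℝ) (f : Ω → α) :
    entropy p f = -∑ ω, p ω * Real.logb 2 (law p f (f ω)) := by
  rw [← sum_law_mul p f (fun b => Real.logb 2 (law p f b)), entropy, Finset.sum_div,
    ← Finset.sum_neg_distrib]
  exact Finset.sum_congr rfl fun b _ => by simp only [Real.negMulLog, Real.logb]; ring

/-- Gibbs' inequality: the cross entropy relative to a subprobability is at least the entropy. -/
lemma entropy_le_cross [Fintype α] (hp : ∀ ω, 0 ≤ p ω) (hp1 : ∑ ω, p ω = 1) (f : Ω → α)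
    (q : α → ℝ) (hq : ∀ a, 0 ≤ q a) (hqpos : ∀ ω, 0 < p ω → 0 < q (f ω)) (hq1 : ∑ a, q a ≤ 1) :
    entropy p f ≤ -∑ ω, p ω * Real.logb 2 (q (f ω)) := by
  have hl2 : 0 < Real.log 2 := Real.log_pos (by norm_num)
  have key : ∑ ω, p ω * (Real.log (q (f ω)) - Real.log (law p f (f ω))) ≤ 0 := by
    calc ∑ ω, p ω * (Real.log (q (f ω)) - Real.log (law p f (f ω)))
        ≤ ∑ ω, p ω * (q (f ω) / law p f (f ω) - 1) := by
          refine Finset.sum_le_sum fun ω _ => ?_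
          rcases (hp ω).eq_or_lt with h | h
          · simp [← h]
          · have h1 := hqpos ω h
            have h2 := h.trans_le (le_law hp f ω)
            rw [← Real.log_div h1.ne' h2.ne']
            exact mul_le_mul_of_nonneg_left (Real.log_le_sub_one_of_pos (div_pos h1 h2)) h.le
      _ = ∑ a, law p f a * (q a / law p f a) - 1 := by
          rw [sum_law_mul p f (fun a => q a / law p f a)]
          simp only [mul_sub, mul_one, Finset.sum_sub_distrib, hp1]
      _ ≤ ∑ a, q a - 1 := by
          refine sub_le_sub_right (Finset.sum_le_sum fun a _ => ?_) 1
          by_cases h : law p f a = 0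
          · simp [h, hq a]
          · exact (mul_div_cancel₀ _ h).le
      _ ≤ 0 := by linarith
  rw [entropy_eq_sum, neg_le_neg_iff, ← sub_nonpos, ← Finset.sum_sub_distrib]
  have : ∑ ω, (p ω * Real.logb 2 (q (f ω)) - p ω * Real.logb 2 (law p f (f ω)))
      = (∑ ω, p ω * (Real.log (q (f ω)) - Real.log (law p f (f ω)))) / Real.log 2 := by
    rw [Finset.sum_div]
    exact Finset.sum_congr rfl fun ω _ => by simp only [Real.logb]; ring
  rw [this]
  exact div_nonpos_of_nonpos_of_nonneg key hl2.le

/-- A function of a random variable has the smaller entropy; the functional relation is needed on the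
support of `p` only. -/
lemma entropy_le_of_determines [Fintype α] [Fintype β] (hp : ∀ ω, 0 ≤ p ω) {f : Ω → α} {g : Ω → β}
    (h : ∀ ω ω', 0 < p ω → 0 < p ω' → g ω = g ω' → f ω = f ω') : entropy p f ≤ entropy p g := by
  classical
  rw [entropy_eq_sum, entropy_eq_sum, neg_le_neg_iff]
  refine Finset.sum_le_sum fun ω _ => ?_
  rcases (hp ω).eq_or_lt with h0 | h0
  · simp [← h0]
  · refine mul_le_mul_of_nonneg_left ?_ h0.le
    refine Real.logb_le_logb_of_le (by norm_num) (h0.trans_le (le_law hp g ω)) ?_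
    refine Finset.sum_le_sum fun ω' _ => ?_
    rcases (hp ω').eq_or_lt with h0' | h0'
    · simp [← h0']
    by_cases h1 : g ω' = g ω
    · simp [h1, h _ _ h0' h0 h1]
    · simp only [h1, if_false]; split_ifs <;> simp [hp]

lemma entropy_congr [Fintype α] [Fintype β] (hp : ∀ ω, 0 ≤ p ω) {f : Ω → α} {g : Ω → β}
    (h : ∀ ω ω', f ω = f ω' ↔ g ω = g ω') : entropy p f = entropy p g :=
  le_antisymm (entropy_le_of_determines hp fun ω ω' _ _ => (h ω ω').2)
    (entropy_le_of_determines hp fun ω ω' _ _ => (h ω ω').1)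

lemma entropy_const (hp1 : ∑ ω, p ω = 1) : entropy p (fun _ : Ω => ()) = 0 := by
  simp [entropy_eq_sum, law, hp1]

lemma condMutualInfo_nonneg [Fintype α] [Fintype β] [Fintype γ] (hp : ∀ ω, 0 ≤ p ω)
    (hp1 : ∑ ω, p ω = 1) (f : Ω → α) (g : Ω → β) (h : Ω → γ) :
    0 ≤ condMutualInfo p f g h := by
  have key := entropy_le_cross hp hp1 (fun ω => (f ω, g ω, h ω))
    (fun x => law p (fun ω => (f ω, h ω)) (x.1, x.2.2) * law p (fun ω => (g ω, h ω)) (x.2.1, x.2.2)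
      / law p h x.2.2)
    (fun x => div_nonneg (mul_nonneg (law_nonneg hp _ _) (law_nonneg hp _ _)) (law_nonneg hp _ _))
    (fun ω h0 => div_pos (mul_pos (h0.trans_le (le_law hp (fun ω => (f ω, h ω)) ω))
      (h0.trans_le (le_law hp (fun ω => (g ω, h ω)) ω))) (h0.trans_le (le_law hp h ω)))
    (by
      rw [Fintype.sum_prod_type]
      simp_rw [Fintype.sum_prod_type]
      rw [Finset.sum_congr rfl fun _ _ => Finset.sum_comm, Finset.sum_comm]
      rw [← hp1, ← sum_law p h]
      refine Finset.sum_le_sum fun z _ => ?_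
      simp_rw [← Finset.sum_div, ← Finset.mul_sum, ← Finset.sum_mul]
      rw [sum_law_prod_left, sum_law_prod_left]
      by_cases h0 : law p h z = 0
      · simp [h0]
      · rw [mul_div_cancel_right₀ _ h0])
  have e : ∑ ω, p ω * Real.logb 2 (law p (fun ω => (f ω, h ω)) (f ω, h ω)
        * law p (fun ω => (g ω, h ω)) (g ω, h ω) / law p h (h ω))
      = -entropy p (fun ω => (f ω, h ω)) - entropy p (fun ω => (g ω, h ω)) + entropy p h := by
    simp only [entropy_eq_sum]
    rw [neg_neg, sub_neg_eq_add, ← Finset.sum_neg_distrib, ← Finset.sum_add_distrib,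
      ← Finset.sum_add_distrib]
    refine Finset.sum_congr rfl fun ω _ => ?_
    rcases (hp ω).eq_or_lt with h0 | h0
    · simp [← h0]
    · have h1 := h0.trans_le (le_law hp (fun ω => (f ω, h ω)) ω)
      have h2 := h0.trans_le (le_law hp (fun ω => (g ω, h ω)) ω)
      have h3 := h0.trans_le (le_law hp h ω)
      rw [Real.logb_div (mul_pos h1 h2).ne' h3.ne', Real.logb_mul h1.ne' h2.ne']
      ring
  simp only at key
  rw [e] at key
  unfold condMutualInfo
  linarith

lemma mutualInfo_nonneg [Fintype α] [Fintype β] (hp : ∀ ω, 0 ≤ p ω)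
    (hp1 : ∑ ω, p ω = 1) (f : Ω → α) (g : Ω → β) : 0 ≤ mutualInfo p f g := by
  have := condMutualInfo_nonneg hp hp1 f g (fun _ => ())
  unfold condMutualInfo at this
  rw [entropy_const hp1, entropy_congr hp (f := fun ω => (f ω, ())) (g := f) (by simp),
    entropy_congr hp (f := fun ω => (g ω, ())) (g := g) (by simp),
    entropy_congr hp (f := fun ω => (f ω, g ω, ())) (g := fun ω => (f ω, g ω)) (by simp)] at this
  unfold mutualInfo
  linarith

/-- The chain rule `H(f, g) = H(f) + H(g | f)`, for a version `κ` of the conditional law. The rows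
`κ a` with `P(f = a) = 0` are arbitrary. -/
lemma entropy_prod_of_kernel [Fintype α] [Fintype β] {f : Ω → α} {g : Ω → β} {κ : α → β → ℝ}
    (h : ∀ a b, law p (fun ω => (f ω, g ω)) (a, b) = law p f a * κ a b) :
    entropy p (fun ω => (f ω, g ω)) = entropy p f + ∑ a, law p f a * shannon (κ a) := by
  simp only [entropy, shannon, Fintype.sum_prod_type, h, Real.negMulLog_mul, ← mul_div_assoc]
  rw [← Finset.sum_div, ← add_div, ← Finset.sum_add_distrib]
  congr 1
  refine Finset.sum_congr rfl fun a _ => ?_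
  rw [Finset.sum_add_distrib, ← Finset.sum_mul, ← Finset.mul_sum]
  congr 1
  by_cases h0 : law p f a = 0
  · simp [h0]
  · have h1 := sum_law_prod_right p f g a
    simp_rw [h, ← Finset.mul_sum] at h1
    rw [mul_eq_left₀ h0 |>.1 h1, one_mul]

/-- Fano's inequality. -/
lemma fano [Fintype α] [Fintype β] [DecidableEq α] (hp : ∀ ω, 0 ≤ p ω) (hp1 : ∑ ω, p ω = 1)
    (f : Ω → α) (g : Ω → β) (d : β → Option α) :
    entropy p (fun ω => (f ω, g ω)) ≤ entropy p g + 1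
      + (∑ ω, if d (g ω) = some (f ω) then 0 else p ω) * Real.logb 2 (Fintype.card α) := by
  rcases isEmpty_or_nonempty Ω with hΩ | ⟨⟨ω₀⟩⟩
  · simp at hp1
  have hc : 0 < (Fintype.card α : ℝ) := by
    exact_mod_cast Fintype.card_pos_iff.2 ⟨f ω₀⟩
  -- the guess `d` is trusted with probability `1 / 2`, and otherwise a uniform guess is made
  have key := entropy_le_cross hp hp1 (fun ω => (f ω, g ω))
    (fun x => law p g x.2 * ((if d x.2 = some x.1 then 1 else (Fintype.card α : ℝ)⁻¹) / 2))
    (fun x => mul_nonneg (law_nonneg hp _ _) (by split_ifs <;> positivity))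
    (fun ω h0 => mul_pos (h0.trans_le (le_law hp g ω)) (by dsimp only; split_ifs <;> positivity))
    (by
      rw [Fintype.sum_prod_type, Finset.sum_comm]
      simp only [← Finset.mul_sum, ← Finset.sum_div]
      refine le_of_le_of_eq ?_ ((sum_law p g).trans hp1)
      refine Finset.sum_le_sum fun b _ => ?_
      refine mul_le_of_le_one_right (law_nonneg hp _ _) ?_
      have h1 : ∑ x, (if d b = some x then 1 else (Fintype.card α : ℝ)⁻¹)
          ≤ ∑ x, ((if d b = some x then 1 else 0) + (Fintype.card α : ℝ)⁻¹) :=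
        Finset.sum_le_sum fun x _ => by split_ifs <;> simp [hc.le]
      have h2 : ∑ x : α, (if d b = some x then (1 : ℝ) else 0) ≤ 1 := by
        cases hd : d b <;> simp
      have h3 : ∑ _x : α, (Fintype.card α : ℝ)⁻¹ = 1 := by
        simp [hc.ne']
      rw [Finset.sum_add_distrib, h3] at h1
      linarith)
  refine key.trans ?_
  have e : ∀ ω, p ω * Real.logb 2 (law p g (g ω) * ((if d (g ω) = some (f ω) then 1
        else (Fintype.card α : ℝ)⁻¹) / 2))
      = p ω * Real.logb 2 (law p g (g ω)) - p ω
        - (if d (g ω) = some (f ω) then 0 else p ω) * Real.logb 2 (Fintype.card α) := by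
    intro ω
    rcases (hp ω).eq_or_lt with h0 | h0
    · simp [← h0]
    · have h1 := h0.trans_le (le_law hp g ω)
      split_ifs with h
      · rw [Real.logb_mul h1.ne' (by norm_num), Real.logb_div (by norm_num) (by norm_num)]
        simp; ring
      · rw [Real.logb_mul h1.ne' (by positivity), Real.logb_div (by positivity) (by norm_num),
          Real.logb_inv, Real.logb_self_eq_one (by norm_num)]
        ring
  simp only [e, Finset.sum_sub_distrib, ← Finset.sum_mul, hp1]
  rw [entropy_eq_sum p g]
  linarith

end InformationMeasures

/-! ### Entropy and divergence of probability mass functions -/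

section PmfEntropy

variable {α β ι : Type*} [Fintype α]

lemma continuous_shannon : Continuous (shannon : (α → ℝ) → ℝ) :=
  (continuous_finsetSum _ fun b _ =>
    Real.continuous_negMulLog.comp (continuous_apply b)).div_const _

lemma shannon_uniform (n : ℕ) (hn : 0 < n) :
    shannon (fun _ : Fin n => 1 / (n : ℝ)) = Real.logb 2 n := by
  have : (n : ℝ) ≠ 0 := by positivity
  simp only [shannon, Real.negMulLog, Finset.sum_const, Finset.card_univ, Fintype.card_fin,
    nsmul_eq_mul, one_div, Real.log_inv, Real.logb]
  field_simp

/-- Concavity of the entropy, for averages. -/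
lemma shannon_average_ge [Fintype ι] [Nonempty ι] (q : ι → α → ℝ) (hq : ∀ i a, 0 ≤ q i a) :
    (∑ i, shannon (q i)) / Fintype.card ι ≤ shannon (fun a => (∑ i, q i a) / Fintype.card ι) := by
  have hl2 : 0 < Real.log 2 := Real.log_pos (by norm_num)
  have hc : (0 : ℝ) < Fintype.card ι := by exact_mod_cast Fintype.card_pos
  simp only [shannon]
  rw [← Finset.sum_div, div_right_comm, Finset.sum_comm]
  refine div_le_div_of_nonneg_right ?_ hl2.le
  rw [Finset.sum_div]
  refine Finset.sum_le_sum fun a _ => ?_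
  have := Real.concaveOn_negMulLog.le_map_sum (t := Finset.univ)
    (w := fun _ : ι => (Fintype.card ι : ℝ)⁻¹) (p := fun i => q i a)
    (fun _ _ => by positivity) (by simp [hc.ne']) (fun i _ => hq i a)
  simpa [← Finset.mul_sum, div_eq_inv_mul] using this

/-- A Pinsker-type bound, through the Hellinger distance: the squared `L¹` distance is at most
four times the divergence in nats. -/
lemma sq_sum_abs_sub_le (P Q : α → ℝ) (hP : P ∈ stdSimplex ℝ α) (hQ : Q ∈ stdSimplex ℝ α)
    (hac : ∀ x, Q x = 0 → P x = 0) :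
    (∑ x, |P x - Q x|) ^ 2 ≤ 4 * (Real.log 2 * ∑ x, P x * Real.logb 2 (P x / Q x)) := by
  have hl2 : 0 < Real.log 2 := Real.log_pos (by norm_num)
  have h1 : ∑ x, (√(P x) - √(Q x)) ^ 2 ≤ Real.log 2 * ∑ x, P x * Real.logb 2 (P x / Q x) := by
    have e : ∑ x, (√(P x) - √(Q x)) ^ 2 = ∑ x, (2 * P x - 2 * (√(P x) * √(Q x))) := by
      have : ∀ x, (√(P x) - √(Q x)) ^ 2 = (2 * P x - 2 * (√(P x) * √(Q x))) + (Q x - P x) := by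
        intro x
        have := Real.sq_sqrt (hP.1 x)
        have := Real.sq_sqrt (hQ.1 x)
        nlinarith
      simp only [this]
      rw [Finset.sum_add_distrib, Finset.sum_sub_distrib (f := Q), hP.2, hQ.2]
      simp
    rw [e, Finset.mul_sum]
    refine Finset.sum_le_sum fun x _ => ?_
    rcases (hP.1 x).eq_or_lt with h | h
    · simp [← h]
    have hq : 0 < Q x := lt_of_le_of_ne (hQ.1 x) fun h0 => h.ne' (hac x h0.symm)
    have h2 := Real.log_le_sub_one_of_pos (div_pos (Real.sqrt_pos.2 hq) (Real.sqrt_pos.2 h))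
    rw [Real.log_div (Real.sqrt_pos.2 hq).ne' (Real.sqrt_pos.2 h).ne', Real.log_sqrt hq.le,
      Real.log_sqrt h.le] at h2
    have h3 : Real.log 2 * (P x * Real.logb 2 (P x / Q x))
        = P x * (Real.log (P x) - Real.log (Q x)) := by
      rw [Real.logb, Real.log_div h.ne' hq.ne']; field_simp
    have h4 : P x * (√(Q x) / √(P x)) = √(P x) * √(Q x) := by
      have := (Real.sqrt_pos.2 h).ne'
      field_simp
      rw [Real.sq_sqrt h.le]
    rw [h3]
    nlinarith [mul_le_mul_of_nonneg_left h2 h.le]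
  have h2 : (∑ x, |P x - Q x|) ^ 2
      ≤ (∑ x, (√(P x) - √(Q x)) ^ 2) * ∑ x, (√(P x) + √(Q x)) ^ 2 := by
    have e : ∀ x, |P x - Q x| = |√(P x) - √(Q x)| * (√(P x) + √(Q x)) := by
      intro x
      rw [← abs_of_nonneg (add_nonneg (Real.sqrt_nonneg (P x)) (Real.sqrt_nonneg (Q x))), ← abs_mul]
      congr 1
      have := Real.sq_sqrt (hP.1 x)
      have := Real.sq_sqrt (hQ.1 x)
      nlinarith
    simp only [e]
    simpa using Finset.sum_mul_sq_le_sq_mul_sq Finset.univ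
      (fun x => |√(P x) - √(Q x)|) (fun x => √(P x) + √(Q x))
  have h3 : ∑ x, (√(P x) + √(Q x)) ^ 2 ≤ 4 := by
    have : ∑ x, (√(P x) + √(Q x)) ^ 2 ≤ ∑ x, (2 * P x + 2 * Q x) := by
      refine Finset.sum_le_sum fun x _ => ?_
      have := Real.sq_sqrt (hP.1 x)
      have := Real.sq_sqrt (hQ.1 x)
      nlinarith [sq_nonneg (√(P x) - √(Q x))]
    rw [Finset.sum_add_distrib, ← Finset.mul_sum, ← Finset.mul_sum, hP.2, hQ.2] at this
    linarith
  have h4 : 0 ≤ ∑ x, (√(P x) - √(Q x)) ^ 2 := Finset.sum_nonneg fun x _ => sq_nonneg _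
  nlinarith

end PmfEntropy

/-! ### Sums of causal products -/

section CausalSums

variable {α β : Type*} [Fintype α] [Fintype β]

lemma sum_prod_past (N : ℕ) (k : (t : Fin N) → (Fin (t : ℕ) → α) → α → ℝ)
    (hk : ∀ t w, ∑ b, k t w b = 1) :
    ∑ x : Fin N → α, ∏ t, k t (past x t) (x t) = 1 := by
  induction N with
  | zero => simp
  | succ N ih =>
    rw [← (Fin.snocEquiv (fun _ : Fin (N + 1) => α)).sum_comp, Fintype.sum_prod_type,
      Finset.sum_comm]
    rw [← ih (fun t => k t.castSucc) (fun t w => hk t.castSucc w)]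
    refine Finset.sum_congr rfl fun x _ => ?_
    have h1 : ∀ b (t : Fin N), past (Fin.snoc (α := fun _ => α) x b) t.castSucc = past x t := by
      intro b t
      funext i
      exact Fin.snoc_castSucc (α := fun _ : Fin (N + 1) => α) b x (Fin.castLE t.is_lt.le i)
    have h2 : ∀ b, past (Fin.snoc (α := fun _ => α) x b) (Fin.last N) = x := by
      intro b
      funext i
      exact Fin.snoc_castSucc (α := fun _ : Fin (N + 1) => α) b x i
    simp only [Fin.snocEquiv_apply, Fin.prod_univ_castSucc, Fin.snoc_castSucc, Fin.snoc_last]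
    have h0 : ∀ b (t : Fin N), k t.castSucc (past (Fin.snoc (α := fun _ => α) x b) t.castSucc) (x t)
        = k t.castSucc (past x t) (x t) := fun b t => by rw [h1]
    refine (Finset.sum_congr rfl fun b _ => congrArg (· * _)
      (Finset.prod_congr rfl fun t _ => h0 b t)).trans ?_
    rw [← Finset.mul_sum]
    have h3 : ∀ b, k (Fin.last N) (past (Fin.snoc (α := fun _ => α) x b) (Fin.last N)) b
        = k (Fin.last N) x b := fun b => by rw [h2]
    have h4 := (Finset.sum_congr rfl fun b _ => h3 b).trans (hk (Fin.last N) x)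
    exact (congrArg (_ * ·) h4).trans (mul_one _)

lemma sum_prod_eq_one {N : ℕ} (w : Fin N → β → ℝ) (hw : ∀ t, ∑ b, w t b = 1) :
    ∑ v : Fin N → β, ∏ t, w t (v t) = 1 :=
  sum_prod_past N (fun t _ => w t) (fun t _ => hw t)

/-- Under a product measure, the coordinate `t` is independent of the functions of the other
coordinates. -/
lemma sum_ite_mul_prod {N : ℕ} (w : Fin N → β → ℝ) (t : Fin N) (hw : ∑ b, w t b = 1)
    (F : (Fin N → β) → ℝ) (hF : ∀ v v', (∀ i, i ≠ t → v i = v' i) → F v = F v') [DecidableEq β]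
    (b : β) :
    ∑ v : Fin N → β, (if v t = b then F v * ∏ i, w i (v i) else 0)
      = (∑ v : Fin N → β, F v * ∏ i, w i (v i)) * w t b := by
  set e := (Equiv.funSplitAt t β).symm
  have he : ∀ c r, e (c, r) t = c := fun c r => by
    simp [e, Equiv.funSplitAt, Equiv.piSplitAt]
  have hr : ∀ c r (j : {j // j ≠ t}), e (c, r) j = r j := fun c r j => by
    simp [e, Equiv.funSplitAt, Equiv.piSplitAt, j.2]
  have hp : ∀ c r, ∏ i, w i (e (c, r) i) = w t c * ∏ j : {j // j ≠ t}, w j (r j) := by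
    intro c r
    rw [Fintype.prod_eq_mul_prod_compl t, he]
    congr 1
    rw [Finset.prod_subtype (p := fun j => j ≠ t) _ (by simp)]
    exact Finset.prod_congr rfl fun j _ => by rw [hr]
  have hFe : ∀ c r, F (e (c, r)) = F (e (b, r)) := fun c r =>
    hF _ _ fun i hi => by rw [hr c r ⟨i, hi⟩, hr b r ⟨i, hi⟩]
  rw [← e.sum_comp, ← e.sum_comp, Fintype.sum_prod_type, Fintype.sum_prod_type]
  simp only [he, hp]
  rw [Finset.sum_comm, Finset.sum_comm, Finset.sum_mul, Finset.sum_comm]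
  simp only [Finset.sum_ite_eq', Finset.mem_univ, if_true]
  conv_rhs => rw [← Finset.sum_mul, Finset.sum_comm, Finset.sum_mul]
  refine Finset.sum_congr rfl fun r _ => ?_
  have : ∀ c, F (e (c, r)) * (w t c * ∏ j : {j // j ≠ t}, w j (r j))
      = (F (e (b, r)) * ∏ j : {j // j ≠ t}, w j (r j)) * w t c := fun c => by
    rw [hFe c r]; ring
  simp only [this, ← Finset.mul_sum, hw, mul_one]

end CausalSums

/-! ### The joint law of a code -/

section CodeLaw

/-- The sample space of `(M, K, A^N, S^N, X^N, Y^N, Z^N)`, on which `Code.joint` is a law. -/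
abbrev Transcript (A S X Y Z : Type*) (M κ N : ℕ) :=
  Fin M × Fin κ × (Fin N → A) × (Fin N → S) × (Fin N → X) × (Fin N → Y) × (Fin N → Z)

namespace Transcript

variable {A S X Y Z : Type*} {M κ N : ℕ}

abbrev msg (ω : Transcript A S X Y Z M κ N) : Fin M := ω.1

abbrev key (ω : Transcript A S X Y Z M κ N) : Fin κ := ω.2.1

abbrev actions (ω : Transcript A S X Y Z M κ N) : Fin N → A := ω.2.2.1

abbrev states (ω : Transcript A S X Y Z M κ N) : Fin N → S := ω.2.2.2.1

abbrev inputs (ω : Transcript A S X Y Z M κ N) : Fin N → X := ω.2.2.2.2.1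

abbrev outputs (ω : Transcript A S X Y Z M κ N) : Fin N → Y := ω.2.2.2.2.2.1

abbrev observations (ω : Transcript A S X Y Z M κ N) : Fin N → Z := ω.2.2.2.2.2.2

end Transcript

open Transcript

variable {A S X Y Z γ : Type*} [Fintype A] [Fintype S] [Fintype X] [Fintype Y] [Fintype Z]
  {M N : ℕ} (C : Code A S X Y M N) (ch : ActionChannel A S X Y Z)

lemma Code.joint_nonneg (ω) : 0 ≤ C.joint ch ω := by
  obtain ⟨m, k, a, s, x, y, z⟩ := ω
  have h1 := Finset.prod_nonneg (s := Finset.univ)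
    fun t _ => (C.actionEnc_mem m k t (past a t)).1 (a t)
  have h2 := Finset.prod_nonneg (s := Finset.univ) fun t _ => (ch.Q_mem (a t)).1 (s t)
  have h3 := Finset.prod_nonneg (s := Finset.univ)
    fun t _ => (C.inputEnc_mem m k a s t (past x t)).1 (x t)
  have h4 := Finset.prod_nonneg (s := Finset.univ) fun t _ => (ch.W_mem (x t) (s t)).1 (y t, z t)
  exact mul_nonneg (mul_nonneg (mul_nonneg (mul_nonneg (by positivity) h1) h2) h3) h4

omit [Fintype A] [Fintype X] in
lemma sum_outputs (s : Fin N → S) (x : Fin N → X) :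
    ∑ y : Fin N → Y, ∑ z : Fin N → Z, ∏ t, ch.W (x t) (s t) (y t, z t) = 1 := by
  rw [← sum_prod_eq_one (fun t => ch.W (x t) (s t)) (fun t => (ch.W_mem _ _).2),
    ← (Equiv.arrowProdEquivProdArrow (Fin N) (fun _ => Y) (fun _ => Z)).symm.sum_comp,
    Fintype.sum_prod_type]
  rfl

lemma law_actions_states (m : Fin M) (k : Fin C.keyCard) (a : Fin N → A) (s : Fin N → S) :
    law (C.joint ch) (fun ω => ((msg ω, key ω, actions ω), states ω)) ((m, k, a), s)
      = (1 / (M : ℝ)) * (1 / (C.keyCard : ℝ)) * (∏ t, C.actionEnc m k t (past a t) (a t))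
        * ∏ t, ch.Q (a t) (s t) := by
  classical
  have h : law (C.joint ch) (fun ω => ((msg ω, key ω, actions ω), states ω)) ((m, k, a), s)
      = ∑ x, ∑ y, ∑ z, C.joint ch (m, k, a, s, x, y, z) := by
    simp only [law_apply, Fintype.sum_prod_type, msg, key, actions, states, Prod.mk.injEq, ite_and, Finset.sum_ite_irrel,
      Finset.sum_const_zero, Finset.sum_ite_eq', Finset.mem_univ, if_true]
    exact (Finset.sum_eq_single s (fun s' _ h => by simp [h]) (by simp)).trans (by simp)
  rw [h]
  simp only [Code.joint, ← Finset.mul_sum, sum_outputs, mul_one]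
  rw [sum_prod_past N (C.inputEnc m k a s) (fun t w => (C.inputEnc_mem m k a s t w).2), mul_one]

lemma law_actions (m : Fin M) (k : Fin C.keyCard) (a : Fin N → A) :
    law (C.joint ch) (fun ω => (msg ω, key ω, actions ω)) (m, k, a)
      = (1 / (M : ℝ)) * (1 / (C.keyCard : ℝ)) * (∏ t, C.actionEnc m k t (past a t) (a t)) := by
  rw [← sum_law_prod_right (C.joint ch) (fun ω => (msg ω, key ω, actions ω)) states]
  simp only [law_actions_states, ← Finset.mul_sum]
  rw [sum_prod_eq_one (fun t => ch.Q (a t)) (fun t => (ch.Q_mem _).2), mul_one]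

/-- The states are drawn independently from the actions, whatever the message and the key. -/
lemma law_states (τ : Fin M × Fin C.keyCard × (Fin N → A)) (s : Fin N → S) :
    law (C.joint ch) (fun ω => ((msg ω, key ω, actions ω), states ω)) (τ, s)
      = law (C.joint ch) (fun ω => (msg ω, key ω, actions ω)) τ * ∏ t, ch.Q (τ.2.2 t) (s t) := by
  obtain ⟨m, k, a⟩ := τ
  rw [law_actions_states, law_actions]

lemma law_msg_key (m : Fin M) (k : Fin C.keyCard) :
    law (C.joint ch) (fun ω => (key ω, msg ω)) (k, m)
      = (1 / (C.keyCard : ℝ)) * (1 / (M : ℝ)) := by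
  classical
  rw [law_comp (C.joint ch) (fun ω => (msg ω, key ω, actions ω)) (fun τ => (τ.2.1, τ.1)), law_apply]
  simp only [Fintype.sum_prod_type, Prod.mk.injEq, ite_and, Finset.sum_ite_irrel,
      Finset.sum_const_zero, Finset.sum_ite_eq', Finset.mem_univ, if_true, law_actions]
  rw [← Finset.mul_sum,
    sum_prod_past N (C.actionEnc m k) (fun t w => (C.actionEnc_mem m k t w).2), mul_one]
  ring

lemma law_key (hM : 0 < M) (k : Fin C.keyCard) :
    law (C.joint ch) key k = 1 / (C.keyCard : ℝ) := by
  have : (M : ℝ) ≠ 0 := by positivity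
  rw [← sum_law_prod_right (C.joint ch) key msg]
  simp only [law_msg_key, Finset.sum_const, Finset.card_univ, Fintype.card_fin, nsmul_eq_mul]
  field_simp

lemma sum_joint (hM : 0 < M) : ∑ ω, C.joint ch ω = 1 := by
  have : (C.keyCard : ℝ) ≠ 0 := by have := C.keyCard_pos; positivity
  rw [← sum_law (C.joint ch) key]
  simp [law_key C ch hM, this]

lemma errorProb_eq : C.errorProb ch
    = ∑ ω : Transcript A S X Y Z M C.keyCard N,
      if C.decode (outputs ω) (key ω) = some (msg ω) then 0 else C.joint ch ω := by
  simp only [Code.errorProb, Fintype.sum_prod_type]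

lemma wardenLaw_eq : C.wardenLaw ch = law (C.joint ch) observations := by
  classical
  funext z
  simp only [Code.wardenLaw, law_apply, observations, Fintype.sum_prod_type, Finset.sum_ite_eq', Finset.mem_univ,
    if_true]

/-- The channel is memoryless: the outputs at time `t` are drawn from `W` whatever is known of the
transcript, as long as it does not involve these outputs. -/
lemma law_outputs (t : Fin N) (Φ : Transcript A S X Y Z M C.keyCard N → γ) (φ : γ → X × S)
    (hφ : ∀ ω, φ (Φ ω) = (inputs ω t, states ω t))
    (hΦ : ∀ m k a s x y z y' z', (∀ i, i ≠ t → y i = y' i) → (∀ i, i ≠ t → z i = z' i) →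
      Φ (m, k, a, s, x, y, z) = Φ (m, k, a, s, x, y', z')) (c : γ) (b : Y × Z) :
    law (C.joint ch) (fun ω => (Φ ω, (outputs ω t, observations ω t))) (c, b)
      = law (C.joint ch) Φ c * ch.W (φ c).1 (φ c).2 b := by
  classical
  simp only [law_apply, Fintype.sum_prod_type (α₁ := Fin M), Fintype.sum_prod_type (α₁ := Fin C.keyCard),
    Fintype.sum_prod_type (α₁ := Fin N → A), Fintype.sum_prod_type (α₁ := Fin N → S),
    Fintype.sum_prod_type (α₁ := Fin N → X), Finset.sum_mul]
  refine Finset.sum_congr rfl fun m _ => Finset.sum_congr rfl fun k _ =>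
    Finset.sum_congr rfl fun a _ => Finset.sum_congr rfl fun s _ => Finset.sum_congr rfl fun x _ =>
      ?_
  set q : ℝ := (1 / (M : ℝ)) * (1 / (C.keyCard : ℝ))
      * (∏ t, C.actionEnc m k t (past a t) (a t))
      * (∏ t, ch.Q (a t) (s t))
      * (∏ t, C.inputEnc m k a s t (past x t) (x t))
  set e := (Equiv.arrowProdEquivProdArrow (Fin N) (fun _ => Y) (fun _ => Z))
  rw [← Finset.sum_mul, ← e.sum_comp, ← e.sum_comp]
  have key := sum_ite_mul_prod (fun t => ch.W (x t) (s t)) t (ch.W_mem _ _).2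
    (fun v => if Φ (m, k, a, s, x, e v) = c then q else 0)
    (fun v v' h => by
      have : Φ (m, k, a, s, x, e v) = Φ (m, k, a, s, x, e v') :=
        hΦ _ _ _ _ _ _ _ _ _ (fun i hi => by rw [h i hi]) (fun i hi => by rw [h i hi])
      simp only [this]) b
  have hl : ∀ v : Fin N → Y × Z,
      (if (Φ (m, k, a, s, x, e v), (e v).1 t, (e v).2 t) = (c, b)
        then C.joint ch (m, k, a, s, x, e v) else 0)
      = if v t = b then (if Φ (m, k, a, s, x, e v) = c then q else 0)
          * ∏ i, ch.W (x i) (s i) (v i) else 0 := by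
    intro v
    have h1 : ((e v).1 t, (e v).2 t) = v t := rfl
    have h2 : C.joint ch (m, k, a, s, x, e v) = q * ∏ i, ch.W (x i) (s i) (v i) := rfl
    rw [h1, h2]
    simp only [Prod.mk.injEq]
    by_cases h3 : v t = b <;> by_cases h4 : Φ (m, k, a, s, x, e v) = c <;> simp [h3, h4]
  have hr : ∀ v : Fin N → Y × Z,
      (if Φ (m, k, a, s, x, e v) = c then q else 0) * ∏ i, ch.W (x i) (s i) (v i)
      = if Φ (m, k, a, s, x, e v) = c then C.joint ch (m, k, a, s, x, e v) else 0 := by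
    intro v
    rw [ite_mul, zero_mul]
    rfl
  refine (Finset.sum_congr rfl fun v _ => hl v).trans (key.trans ?_)
  simp only [hr]
  by_cases hc : ∃ v : Fin N → Y × Z, Φ (m, k, a, s, x, e v) = c
  · obtain ⟨v, hv⟩ := hc
    have := hφ (m, k, a, s, x, e v)
    rw [hv] at this
    rw [this]
  · push Not at hc
    simp [hc]

end CodeLaw

/-! ### Entropies of sequences -/

section SequenceEntropy

variable {Ω α β : Type*} [Fintype Ω] [Fintype α] [Fintype β] {p : Ω → ℝ}

lemma entropy_seq_le (hp : ∀ ω, 0 ≤ p ω) (hp1 : ∑ ω, p ω = 1) {N : ℕ} (f : Fin N → Ω → α) :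
    entropy p (fun ω t => f t ω) ≤ ∑ t, entropy p (f t) := by
  induction N with
  | zero =>
    rw [entropy_congr hp (g := fun _ => ()) (fun ω ω' => by simp [eq_iff_true_of_subsingleton]),
      entropy_const hp1]
    simp
  | succ N ih =>
    have h1 := mutualInfo_nonneg hp hp1 (fun ω (t : Fin N) => f t.castSucc ω) (f (Fin.last N))
    have h2 := ih (fun t => f t.castSucc)
    have h3 : entropy p (fun ω t => f t ω)
        = entropy p (fun ω => ((fun t : Fin N => f t.castSucc ω), f (Fin.last N) ω)) :=
      entropy_congr hp fun ω ω' => by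
        rw [Prod.mk.injEq, funext_iff, funext_iff, Fin.forall_fin_succ']
    rw [Fin.sum_univ_castSucc, h3]
    unfold mutualInfo at h1
    linarith

lemma shannon_prod {N : ℕ} (w : Fin N → β → ℝ) (hw : ∀ t, ∑ b, w t b = 1) :
    shannon (fun v : Fin N → β => ∏ t, w t (v t)) = ∑ t, shannon (w t) := by
  induction N with
  | zero => simp [shannon]
  | succ N ih =>
    rw [Fin.sum_univ_succ, ← ih (fun t => w t.succ) (fun t => hw _)]
    simp only [shannon]
    rw [← (Fin.consEquiv (fun _ : Fin (N + 1) => β)).sum_comp, Fintype.sum_prod_type]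
    simp only [Fin.consEquiv_apply, Fin.prod_univ_succ, Fin.cons_zero, Fin.cons_succ,
      Real.negMulLog_mul, Finset.sum_add_distrib]
    simp only [← Finset.mul_sum, ← Finset.sum_mul]
    rw [sum_prod_eq_one _ (fun t => hw _), hw]
    ring

end SequenceEntropy

/-! ### The converse in entropies of letters -/

section Converse

open Transcript

variable {A S X Y Z : Type*} [Fintype A] [Fintype S] [Fintype X] [Fintype Y] [Fintype Z]
  {M N : ℕ} (C : Code A S X Y M N) (ch : ActionChannel A S X Y Z)

/-- The state of knowledge after `j` steps in Csiszár's sum identity: the message, the key, the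
actions, the first `j` outputs and the states from time `j` on. -/
def hybrid (j : ℕ) (ω : Transcript A S X Y Z M C.keyCard N) :
    (Fin M × Fin C.keyCard × (Fin N → A)) × (Fin N → Y ⊕ S) :=
  ((msg ω, key ω, actions ω),
    fun i => if (i : ℕ) < j then Sum.inl (outputs ω i) else Sum.inr (states ω i))

/-- The auxiliary variable `U_t = (M, K, A^N, Y^{t-1}, S_{t+1}^N)`. -/
def auxiliary (t : Fin N) (ω : Transcript A S X Y Z M C.keyCard N) :
    (Fin M × Fin C.keyCard × (Fin N → A)) × (Fin N → Option (Y ⊕ S)) :=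
  ((msg ω, key ω, actions ω),
    fun i => if i < t then some (Sum.inl (outputs ω i))
      else if i = t then none else some (Sum.inr (states ω i)))

lemma entropy_auxiliary_state (t : Fin N) :
    entropy (C.joint ch) (fun ω => (auxiliary C t ω, states ω t))
      = entropy (C.joint ch) (hybrid C t) := by
  refine entropy_congr (C.joint_nonneg ch) fun ω ω' => ?_
  simp only [auxiliary, hybrid, Prod.ext_iff, funext_iff]
  constructor
  · rintro ⟨⟨h1, h2⟩, h3⟩
    refine ⟨h1, fun i => ?_⟩
    have := h2 i
    rcases lt_trichotomy i t with h | h | h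
    · simpa [h, Fin.lt_def.1 h] using this
    · subst h; simpa using h3
    · simpa [h.not_gt, h.ne', h.ne, Nat.not_lt.2 (Fin.lt_def.1 h).le] using this
  · rintro ⟨h1, h2⟩
    refine ⟨⟨h1, fun i => ?_⟩, by simpa using h2 t⟩
    have := h2 i
    rcases lt_trichotomy i t with h | h | h
    · simpa [h, Fin.lt_def.1 h] using this
    · simp [h]
    · simpa [h.not_gt, h.ne', h.ne, Nat.not_lt.2 (Fin.lt_def.1 h).le] using this

lemma entropy_auxiliary_output (t : Fin N) :
    entropy (C.joint ch) (fun ω => (auxiliary C t ω, outputs ω t))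
      = entropy (C.joint ch) (hybrid C (t + 1)) := by
  refine entropy_congr (C.joint_nonneg ch) fun ω ω' => ?_
  simp only [auxiliary, hybrid, Prod.ext_iff, funext_iff]
  have e : ∀ i : Fin N, t < i → ¬ (i : ℕ) < t + 1 := fun i h => by
    have := Fin.lt_def.1 h; omega
  have e' : ∀ i : Fin N, i < t → (i : ℕ) < t + 1 := fun i h => by
    have := Fin.lt_def.1 h; omega
  constructor
  · rintro ⟨⟨h1, h2⟩, h3⟩
    refine ⟨h1, fun i => ?_⟩
    have := h2 i
    rcases lt_trichotomy i t with h | h | h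
    · simpa [h, e' i h] using this
    · subst h; simpa using h3
    · simpa [h.not_gt, h.ne', h.ne, e i h] using this
  · rintro ⟨h1, h2⟩
    refine ⟨⟨h1, fun i => ?_⟩, by simpa using h2 t⟩
    have := h2 i
    rcases lt_trichotomy i t with h | h | h
    · simpa [h, e' i h] using this
    · simp [h]
    · simpa [h.not_gt, h.ne', h.ne, e i h] using this

lemma entropy_hybrid_zero :
    entropy (C.joint ch) (hybrid C 0)
      = entropy (C.joint ch) (fun ω => (msg ω, key ω, actions ω))
        + ∑ t : Fin N, ∑ a, law (C.joint ch) (fun ω => actions ω t) a * shannon (ch.Q a) := by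
  have h1 : entropy (C.joint ch) (hybrid C 0)
      = entropy (C.joint ch) (fun ω => ((msg ω, key ω, actions ω), states ω)) :=
    entropy_congr (C.joint_nonneg ch) fun ω ω' => by simp [hybrid, Prod.ext_iff, funext_iff]
  rw [h1, entropy_prod_of_kernel (κ := fun τ s => ∏ t, ch.Q (τ.2.2 t) (s t)) (law_states C ch)]
  congr 1
  have h2 : ∀ τ : Fin M × Fin C.keyCard × (Fin N → A),
      shannon (fun s : Fin N → S => ∏ t, ch.Q (τ.2.2 t) (s t)) = ∑ t, shannon (ch.Q (τ.2.2 t)) :=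
    fun τ => shannon_prod (fun t => ch.Q (τ.2.2 t)) fun t => (ch.Q_mem _).2
  simp only [h2]
  rw [sum_law_mul (C.joint ch) (fun ω => (msg ω, key ω, actions ω))
    (fun τ => ∑ t, shannon (ch.Q (τ.2.2 t)))]
  simp only [sum_law_mul (C.joint ch) _ (fun a => shannon (ch.Q a)), Finset.mul_sum]
  rw [Finset.sum_comm]

lemma entropy_hybrid_end :
    entropy (C.joint ch) (hybrid C N)
      = entropy (C.joint ch) (fun ω => ((msg ω, key ω, actions ω), outputs ω)) :=
  entropy_congr (C.joint_nonneg ch) fun ω ω' => by simp [hybrid, Prod.ext_iff, funext_iff]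

/-- Reliability: Fano's inequality bounds the information that the outputs carry about
`(M, K, A^N)` from below. -/
lemma information_ge (hM : 0 < M) :
    (1 - C.errorProb ch) * Real.logb 2 M - 1
      ≤ mutualInfo (C.joint ch) (fun ω => (msg ω, key ω, actions ω)) outputs := by
  have hp := C.joint_nonneg ch
  have hp1 := sum_joint C ch hM
  have h1 : entropy (C.joint ch) (fun ω => (key ω, msg ω))
      = entropy (C.joint ch) key + Real.logb 2 M := by
    rw [entropy_prod_of_kernel (κ := fun _ _ => 1 / (M : ℝ)) fun k m => by
      rw [law_msg_key, law_key C ch hM]]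
    rw [← Finset.sum_mul, sum_law, hp1, shannon_uniform M hM, one_mul]
  have h2 := fano hp hp1 msg (fun ω => (outputs ω, key ω)) (fun b => C.decode b.1 b.2)
  rw [← errorProb_eq C ch, Fintype.card_fin] at h2
  have h3 := mutualInfo_nonneg hp hp1 outputs key
  -- the actions, in addition to the message and the key, only increase the information
  have h4 := condMutualInfo_nonneg hp hp1 outputs actions (fun ω => (key ω, msg ω))
  unfold condMutualInfo at h4
  have e1 : entropy (C.joint ch) (fun ω => (outputs ω, key ω, msg ω))
      = entropy (C.joint ch) (fun ω => (msg ω, outputs ω, key ω)) :=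
    entropy_congr hp fun ω ω' => by simp only [Prod.mk.injEq]; tauto
  have e2 : entropy (C.joint ch) (fun ω => (actions ω, key ω, msg ω))
      = entropy (C.joint ch) (fun ω => (msg ω, key ω, actions ω)) :=
    entropy_congr hp fun ω ω' => by simp only [Prod.mk.injEq]; tauto
  have e3 : entropy (C.joint ch) (fun ω => (outputs ω, actions ω, key ω, msg ω))
      = entropy (C.joint ch) (fun ω => ((msg ω, key ω, actions ω), outputs ω)) :=
    entropy_congr hp fun ω ω' => by simp only [Prod.mk.injEq]; tauto
  rw [e1, e2, e3] at h4
  unfold mutualInfo at h3 ⊢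
  linarith

/-- The converse in entropies of single letters. The sum over `t` of
`H(S_t | U_t) - H(Y_t | U_t)` telescopes along `hybrid`, which is Csiszár's sum identity. -/
lemma sum_letters_ge (hM : 0 < M) :
    (1 - C.errorProb ch) * Real.logb 2 M - 1 ≤
      ∑ t : Fin N, (entropy (C.joint ch) (fun ω => outputs ω t)
        - ∑ a, law (C.joint ch) (fun ω => actions ω t) a * shannon (ch.Q a)
        + (entropy (C.joint ch) (fun ω => (auxiliary C t ω, states ω t))
          - entropy (C.joint ch) (fun ω => (auxiliary C t ω, outputs ω t)))) := by
  have h1 := information_ge C ch hM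
  have h2 := entropy_seq_le (C.joint_nonneg ch) (sum_joint C ch hM)
    (fun (t : Fin N) ω => outputs ω t)
  have h3 : ∑ t : Fin N, (entropy (C.joint ch) (hybrid C t)
      - entropy (C.joint ch) (hybrid C (t + 1)))
      = entropy (C.joint ch) (hybrid C 0) - entropy (C.joint ch) (hybrid C N) := by
    rw [Fin.sum_univ_eq_sum_range (fun t => entropy (C.joint ch) (hybrid C t)
      - entropy (C.joint ch) (hybrid C (t + 1))), Finset.sum_range_sub']
  rw [entropy_hybrid_zero, entropy_hybrid_end] at h3
  simp only [entropy_auxiliary_state, entropy_auxiliary_output]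
  rw [Finset.sum_add_distrib, h3, Finset.sum_sub_distrib]
  unfold mutualInfo at h1
  change entropy (C.joint ch) outputs ≤ _ at h2
  linarith

end Converse

/-! ### Mixtures of letters -/

section SingleLetterization

open Transcript

variable {A S X Y Z : Type*} [Fintype A] [Fintype S] [Fintype X] [Fintype Y] [Fintype Z]

/-- The law of the receiver's output when the state and the input have the law `ν`. -/
noncomputable def outputLaw (ch : ActionChannel A S X Y Z) (ν : S × X → ℝ) (y : Y) : ℝ :=
  ∑ r, ν r * ∑ z, ch.W r.2 r.1 (y, z)

/-- The law of the warden's output when the state and the input have the law `ν`. -/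
noncomputable def observationLaw (ch : ActionChannel A S X Y Z) (ν : S × X → ℝ) (z : Z) : ℝ :=
  ∑ r, ν r * ∑ y, ch.W r.2 r.1 (y, z)

/-- The marginal law of the state. -/
def stateLaw (ν : S × X → ℝ) (s : S) : ℝ := ∑ x, ν (s, x)

/-- `H(S) - H(Y)` when the state and the input have the law `ν`. -/
noncomputable def gain (ch : ActionChannel A S X Y Z) (ν : S × X → ℝ) : ℝ :=
  shannon (stateLaw ν) - shannon (outputLaw ch ν)

/-- The marginal law of the action. -/
def actionLaw (μ : A × S × X → ℝ) (a : A) : ℝ := ∑ r, μ (a, r)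

/-- The marginal law of the state and the input. -/
def stateInputLaw (μ : A × S × X → ℝ) (r : S × X) : ℝ := ∑ a, μ (a, r)

open Classical in
/-- The law of `(A, S, X)` under which the action is `a` and the state and the input have the
law `ν`. -/
noncomputable def withAction (a : A) (ν : S × X → ℝ) (b : A × S × X) : ℝ :=
  if a = b.1 then ν b.2 else 0

/-- The contributions of one value `u` of an auxiliary variable that determines the action: the
conditional law of `(A, S, X)`, and `H(S | U = u) - H(Y | U = u)`. -/
def letterSet (ch : ActionChannel A S X Y Z) : Set ((A × S × X → ℝ) × ℝ) :=
  {c | ∃ a, ∃ ν ∈ stdSimplex ℝ (S × X), c = (withAction a ν, gain ch ν)}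

/-- `I(U;Y) - I(U;S|A)` in terms of the law `μ` of `(A, S, X)` and of
`g = H(S|U) - H(Y|U)`, when `U` determines `A`. -/
noncomputable def mixtureRate (ch : ActionChannel A S X Y Z) (c : (A × S × X → ℝ) × ℝ) : ℝ :=
  shannon (outputLaw ch (stateInputLaw c.1)) - ∑ a, actionLaw c.1 a * shannon (ch.Q a) + c.2

/-- The state has the conditional law `Q` given the action. -/
def StateConsistent (ch : ActionChannel A S X Y Z) (μ : A × S × X → ℝ) : Prop :=
  ∀ a s, ∑ x, μ (a, s, x) = actionLaw μ a * ch.Q a s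

section Generic

variable {Ω υ : Type*} [Fintype Ω] [Fintype υ] {p : Ω → ℝ} (ch : ActionChannel A S X Y Z)
  {U : Ω → υ} {Av : Ω → A} {Sv : Ω → S} {Xv : Ω → X} {Yv : Ω → Y} {Zv : Ω → Z}

omit [Fintype A] in
lemma law_output_of_memoryless
    (hW : ∀ u r b, law p (fun ω => ((U ω, (Sv ω, Xv ω)), (Yv ω, Zv ω))) ((u, r), b)
      = law p (fun ω => (U ω, (Sv ω, Xv ω))) (u, r) * ch.W r.2 r.1 b) (u : υ) (y : Y) :
    law p (fun ω => (U ω, Yv ω)) (u, y)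
      = ∑ r, law p (fun ω => (U ω, (Sv ω, Xv ω))) (u, r) * ∑ z, ch.W r.2 r.1 (y, z) := by
  classical
  rw [law_comp p (fun ω => ((U ω, (Sv ω, Xv ω)), (Yv ω, Zv ω))) (fun c => (c.1.1, c.2.1)),
    law_apply]
  rw [Fintype.sum_prod_type, Fintype.sum_prod_type]
  simp only [hW, Fintype.sum_prod_type (α₁ := Y), Prod.mk.injEq, Finset.mul_sum]
  rw [Finset.sum_eq_single u (fun u' _ h => by simp [h]) (by simp)]
  refine Finset.sum_congr rfl fun r _ => ?_
  rw [Finset.sum_eq_single y (fun y' _ h => by simp [h]) (by simp)]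
  simp

omit [Fintype A] in
lemma law_observation_of_memoryless
    (hW : ∀ r b, law p (fun ω => ((Sv ω, Xv ω), (Yv ω, Zv ω))) (r, b)
      = law p (fun ω => (Sv ω, Xv ω)) r * ch.W r.2 r.1 b) :
    law p Zv = observationLaw ch (law p (fun ω => (Sv ω, Xv ω))) := by
  classical
  funext z
  rw [law_comp p (fun ω => ((Sv ω, Xv ω), (Yv ω, Zv ω))) (fun c => c.2.2), law_apply,
    Fintype.sum_prod_type, observationLaw]
  simp only [hW, Fintype.sum_prod_type (α₁ := Y), Finset.mul_sum, Finset.sum_ite_eq',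
    Finset.mem_univ, if_true]

omit [Fintype A] in
lemma law_receiver_of_memoryless
    (hW : ∀ r b, law p (fun ω => ((Sv ω, Xv ω), (Yv ω, Zv ω))) (r, b)
      = law p (fun ω => (Sv ω, Xv ω)) r * ch.W r.2 r.1 b) :
    law p Yv = outputLaw ch (law p (fun ω => (Sv ω, Xv ω))) := by
  classical
  funext y
  rw [law_comp p (fun ω => ((Sv ω, Xv ω), (Yv ω, Zv ω))) (fun c => c.2.1), law_apply,
    Fintype.sum_prod_type, outputLaw]
  simp only [hW, Fintype.sum_prod_type (α₁ := Y), Finset.mul_sum]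
  refine Finset.sum_congr rfl fun r _ => ?_
  rw [Finset.sum_eq_single y (fun y' _ h => by simp [h]) (by simp)]
  simp

omit [Fintype A] in
/-- `H(S|U) - H(Y|U)` is the average gain of the conditional laws `ν` of the state and the input
given `U`. -/
lemma entropy_sub_eq_sum_gain {ν : υ → S × X → ℝ}
    (hν : ∀ u r, law p (fun ω => (U ω, (Sv ω, Xv ω))) (u, r) = law p U u * ν u r)
    (hW : ∀ u r b, law p (fun ω => ((U ω, (Sv ω, Xv ω)), (Yv ω, Zv ω))) ((u, r), b)
      = law p (fun ω => (U ω, (Sv ω, Xv ω))) (u, r) * ch.W r.2 r.1 b) :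
    entropy p (fun ω => (U ω, Sv ω)) - entropy p (fun ω => (U ω, Yv ω))
      = ∑ u, law p U u * gain ch (ν u) := by
  classical
  have hS : entropy p (fun ω => (U ω, Sv ω))
      = entropy p U + ∑ u, law p U u * shannon (stateLaw (ν u)) := by
    refine entropy_prod_of_kernel fun u s => ?_
    rw [stateLaw, Finset.mul_sum]
    simp only [← hν]
    rw [← sum_law_prod_right p (fun ω => (U ω, Sv ω)) Xv (u, s)]
    refine Finset.sum_congr rfl fun x _ => ?_
    simp only [law_apply, Prod.mk.injEq, and_assoc]
  have hY : entropy p (fun ω => (U ω, Yv ω))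
      = entropy p U + ∑ u, law p U u * shannon (outputLaw ch (ν u)) := by
    refine entropy_prod_of_kernel fun u y => ?_
    rw [law_output_of_memoryless ch hW, outputLaw, Finset.mul_sum]
    exact Finset.sum_congr rfl fun r _ => by rw [hν, mul_assoc]
  simp only [hS, hY, gain, mul_sub, Finset.sum_sub_distrib]
  ring

omit [Fintype A] in
/-- Conditioning on `U` writes the law of `(A, S, X)` and `H(S|U) - H(Y|U)` as a mixture. -/
lemma mem_convexHull_letterSet (hp : ∀ ω, 0 ≤ p ω) (hp1 : ∑ ω, p ω = 1) (α : υ → A)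
    (hα : ∀ ω, α (U ω) = Av ω)
    (hW : ∀ u r b, law p (fun ω => ((U ω, (Sv ω, Xv ω)), (Yv ω, Zv ω))) ((u, r), b)
      = law p (fun ω => (U ω, (Sv ω, Xv ω))) (u, r) * ch.W r.2 r.1 b) :
    (law p (fun ω => (Av ω, Sv ω, Xv ω)),
      entropy p (fun ω => (U ω, Sv ω)) - entropy p (fun ω => (U ω, Yv ω)))
      ∈ convexHull ℝ (letterSet ch) := by
  classical
  set ν : υ → S × X → ℝ := fun u r => law p (fun ω => (U ω, (Sv ω, Xv ω))) (u, r) / law p U u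
    with hν
  have hνmul : ∀ u r, law p (fun ω => (U ω, (Sv ω, Xv ω))) (u, r) = law p U u * ν u r :=
    fun u r => law_prod_eq_mul_div hp U (fun ω => (Sv ω, Xv ω)) u r
  have hμ : law p (fun ω => (Av ω, Sv ω, Xv ω)) = ∑ u, law p U u • withAction (α u) (ν u) := by
    funext ⟨a, r⟩
    have h1 : (fun ω => (Av ω, Sv ω, Xv ω)) = fun ω => (α (U ω), (Sv ω, Xv ω)) := by
      funext ω; rw [hα]
    rw [h1, law_comp p (fun ω => (U ω, (Sv ω, Xv ω))) (fun c => (α c.1, c.2)), law_apply,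
      Fintype.sum_prod_type, Finset.sum_apply]
    refine Finset.sum_congr rfl fun u _ => ?_
    rw [Finset.sum_eq_single r (fun r' _ h => by simp [h]) (by simp)]
    simp only [Prod.mk.injEq, and_true, Pi.smul_apply, smul_eq_mul, withAction, mul_ite, mul_zero,
      hνmul]
  have hmix : (law p (fun ω => (Av ω, Sv ω, Xv ω)),
      entropy p (fun ω => (U ω, Sv ω)) - entropy p (fun ω => (U ω, Yv ω)))
      = ∑ u, law p U u • ((withAction (α u) (ν u), gain ch (ν u)) : (A × S × X → ℝ) × ℝ) := by
    refine Prod.ext ?_ ?_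
    · simp only [Prod.fst_sum, Prod.smul_fst, hμ]
    · simp only [Prod.snd_sum, Prod.smul_snd, smul_eq_mul]
      exact entropy_sub_eq_sum_gain ch hνmul hW
  rw [hmix, ← Finset.sum_filter_of_ne (p := fun u => law p U u ≠ 0)
    (fun u _ h => left_ne_zero_of_smul h)]
  refine (convex_convexHull ℝ _).sum_mem (fun u _ => law_nonneg hp U u) ?_ fun u hu => ?_
  · rw [Finset.sum_filter_ne_zero, sum_law, hp1]
  · have h0 : law p U u ≠ 0 := (Finset.mem_filter.1 hu).2
    refine subset_convexHull ℝ _ ⟨α u, ν u, ⟨fun r => ?_, ?_⟩, rfl⟩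
    · exact div_nonneg (law_nonneg hp _ _) (law_nonneg hp _ _)
    · rw [hν]
      simp only
      rw [← Finset.sum_div, sum_law_prod_right, div_self h0]

end Generic

variable {M N : ℕ} (C : Code A S X Y M N) (ch : ActionChannel A S X Y Z)

/-- The law of the letters `(A_t, S_t, X_t)`. -/
noncomputable def letterLaw (t : Fin N) : A × S × X → ℝ :=
  law (C.joint ch) (fun ω => (actions ω t, states ω t, inputs ω t))

lemma stateInputLaw_letterLaw (t : Fin N) : stateInputLaw (letterLaw C ch t)
    = law (C.joint ch) (fun ω => (states ω t, inputs ω t)) := by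
  funext r
  exact sum_law_prod_left (C.joint ch) (fun ω => actions ω t) (fun ω => (states ω t, inputs ω t)) r

lemma actionLaw_letterLaw (t : Fin N) : actionLaw (letterLaw C ch t)
    = law (C.joint ch) (fun ω => actions ω t) := by
  funext a
  exact sum_law_prod_right (C.joint ch) (fun ω => actions ω t)
    (fun ω => (states ω t, inputs ω t)) a

lemma law_letter_memoryless (t : Fin N) (r : S × X) (b : Y × Z) :
    law (C.joint ch) (fun ω => ((states ω t, inputs ω t), (outputs ω t, observations ω t))) (r, b)
      = law (C.joint ch) (fun ω => (states ω t, inputs ω t)) r * ch.W r.2 r.1 b :=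
  law_outputs C ch t (fun ω => (states ω t, inputs ω t)) Prod.swap (fun _ => rfl)
    (fun _ _ _ _ _ _ _ _ _ _ _ => rfl) r b

lemma law_observation (t : Fin N) : law (C.joint ch) (fun ω => observations ω t)
    = observationLaw ch (stateInputLaw (letterLaw C ch t)) := by
  rw [stateInputLaw_letterLaw]
  exact law_observation_of_memoryless ch (law_letter_memoryless C ch t)

lemma law_output (t : Fin N) : law (C.joint ch) (fun ω => outputs ω t)
    = outputLaw ch (stateInputLaw (letterLaw C ch t)) := by
  rw [stateInputLaw_letterLaw]
  exact law_receiver_of_memoryless ch (law_letter_memoryless C ch t)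

lemma stateConsistent_letterLaw (t : Fin N) : StateConsistent ch (letterLaw C ch t) := by
  classical
  intro a s
  rw [actionLaw_letterLaw]
  have h1 : ∑ x, letterLaw C ch t (a, s, x)
      = law (C.joint ch) (fun ω => (actions ω t, states ω t)) (a, s) := by
    rw [← sum_law_prod_right (C.joint ch) (fun ω => (actions ω t, states ω t))
      (fun ω => inputs ω t) (a, s)]
    simp only [letterLaw, law_apply, Prod.mk.injEq, and_assoc]
  rw [h1, law_comp (C.joint ch) (fun ω => ((msg ω, key ω, actions ω), states ω))
    (fun c => (c.1.2.2 t, c.2 t)), law_apply, Fintype.sum_prod_type,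
    law_comp (C.joint ch) (fun ω => (msg ω, key ω, actions ω)) (fun c => c.2.2 t), law_apply,
    Finset.sum_mul]
  refine Finset.sum_congr rfl fun τ _ => ?_
  have h2 := sum_ite_mul_prod (fun t => ch.Q (τ.2.2 t)) t (ch.Q_mem _).2 (fun _ => 1)
    (fun _ _ _ => rfl) s
  simp only [one_mul, sum_prod_eq_one (fun t => ch.Q (τ.2.2 t)) (fun t => (ch.Q_mem _).2)] at h2
  by_cases h : τ.2.2 t = a
  · simp only [h, Prod.mk.injEq, true_and, if_true, law_states]
    rw [h] at h2
    rw [← h2, Finset.mul_sum]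
    exact Finset.sum_congr rfl fun v _ => by split_ifs <;> simp
  · simp [h]

/-- The converse in single letters, for a time-sharing average: the letters of a code give a mixture
whose rate is that of the code up to Fano's term. -/
lemma exists_mixture_of_code (hM : 0 < M) (hN : 0 < N) :
    ∃ c ∈ convexHull ℝ (letterSet ch), StateConsistent ch c.1 ∧
      (∀ z, observationLaw ch (stateInputLaw c.1) z
        = (∑ t : Fin N, law (C.joint ch) (fun ω => observations ω t) z) / N) ∧
      ((1 - C.errorProb ch) * Real.logb 2 M - 1) / N ≤ mixtureRate ch c := by
  have hp := C.joint_nonneg ch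
  have hp1 := sum_joint C ch hM
  have : Nonempty (Fin N) := ⟨⟨0, hN⟩⟩
  have hN' : (0 : ℝ) < N := by exact_mod_cast hN
  set g : Fin N → ℝ := fun t => entropy (C.joint ch) (fun ω => (auxiliary C t ω, states ω t))
          - entropy (C.joint ch) (fun ω => (auxiliary C t ω, outputs ω t))
  have hmem : ∀ t, ((letterLaw C ch t, g t) : (A × S × X → ℝ) × ℝ)
      ∈ convexHull ℝ (letterSet ch) := by
    intro t
    refine mem_convexHull_letterSet ch hp hp1 (fun u => u.1.2.2 t) (fun _ => rfl)
      (Zv := fun ω => observations ω t) fun u r b => ?_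
    -- `U_t` does not involve the outputs at time `t`
    refine law_outputs C ch t (fun ω => (auxiliary C t ω, (states ω t, inputs ω t)))
      (fun c => c.2.swap) (fun _ => rfl) (fun m k a s x y z y' z' hy _ => ?_) (u, r) b
    simp only [auxiliary, Prod.mk.injEq, and_true, true_and]
    funext i
    by_cases h : i < t
    · simp only [h, if_true]
      exact congrArg (fun y => some (Sum.inl y)) (hy i h.ne)
    · simp [h]
  have hsI : ∀ r, stateInputLaw ((N : ℝ)⁻¹ • ∑ t, letterLaw C ch t) r
      = (N : ℝ)⁻¹ * ∑ t, stateInputLaw (letterLaw C ch t) r := by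
    intro r
    simp only [stateInputLaw, Pi.smul_apply, Finset.sum_apply, smul_eq_mul, ← Finset.mul_sum]
    rw [Finset.sum_comm]
  have haL : ∀ a, actionLaw ((N : ℝ)⁻¹ • ∑ t, letterLaw C ch t) a
      = (N : ℝ)⁻¹ * ∑ t, actionLaw (letterLaw C ch t) a := by
    intro r
    simp only [actionLaw, Pi.smul_apply, Finset.sum_apply, smul_eq_mul, ← Finset.mul_sum]
    rw [Finset.sum_comm]
  refine ⟨((N : ℝ)⁻¹ • ∑ t, letterLaw C ch t, (N : ℝ)⁻¹ * ∑ t, g t), ?_, ?_, ?_, ?_⟩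
  · have := (convex_convexHull ℝ (letterSet ch)).sum_mem (t := Finset.univ)
      (w := fun _ : Fin N => (N : ℝ)⁻¹) (z := fun t => (letterLaw C ch t, g t))
      (fun _ _ => by positivity) (by simp [hN'.ne']) (fun t _ => hmem t)
    rw [← Finset.smul_sum] at this
    convert this using 1
    refine Prod.ext ?_ ?_
    · simp only [Prod.smul_fst, Prod.fst_sum]
    · simp only [Prod.smul_snd, Prod.snd_sum, smul_eq_mul]
  · intro a s
    rw [haL]
    simp only [Pi.smul_apply, Finset.sum_apply, smul_eq_mul, ← Finset.mul_sum]
    rw [Finset.sum_comm, mul_assoc, Finset.sum_mul]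
    congr 1
    exact Finset.sum_congr rfl fun t _ => stateConsistent_letterLaw C ch t a s
  · intro z
    simp only [law_observation, observationLaw, hsI]
    rw [Finset.sum_comm, Finset.sum_div]
    refine Finset.sum_congr rfl fun r _ => ?_
    rw [← Finset.sum_mul]
    ring
  · have hY : outputLaw ch (stateInputLaw ((N : ℝ)⁻¹ • ∑ t, letterLaw C ch t))
        = fun y => (∑ t : Fin N, law (C.joint ch) (fun ω => outputs ω t) y)
          / Fintype.card (Fin N) := by
      funext z
      simp only [law_output, outputLaw, hsI, Fintype.card_fin]
      rw [Finset.sum_comm, Finset.sum_div]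
      refine Finset.sum_congr rfl fun r _ => ?_
      rw [← Finset.sum_mul]
      ring
    have h1 := shannon_average_ge (fun t : Fin N => law (C.joint ch) (fun ω => outputs ω t))
      (fun t y => law_nonneg hp _ _)
    have h2 := sum_letters_ge C ch hM
    rw [Finset.sum_add_distrib, Finset.sum_sub_distrib] at h2
    have h3 : ∑ a, actionLaw ((N : ℝ)⁻¹ • ∑ t, letterLaw C ch t) a * shannon (ch.Q a)
        = (∑ t : Fin N, ∑ a, law (C.joint ch) (fun ω => actions ω t) a * shannon (ch.Q a)) / N := by
      simp only [haL, actionLaw_letterLaw]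
      rw [Finset.sum_comm, Finset.sum_div]
      refine Finset.sum_congr rfl fun a _ => ?_
      rw [← Finset.sum_mul]
      ring
    have h4 := div_le_div_of_nonneg_right h2 hN'.le
    rw [add_div, sub_div (∑ t : Fin N, entropy (C.joint ch) (fun ω => outputs ω t))] at h4
    simp only [mixtureRate, hY, h3]
    rw [Fintype.card_fin] at h1 ⊢
    refine h4.trans ?_
    rw [← div_eq_inv_mul]
    simp only [entropy_eq_shannon _ (fun ω => outputs ω _)]
    gcongr

end SingleLetterization

/-! ### The law of the warden's letters -/

section Covertness

open Transcript

variable {A S X Y Z : Type*} [Fintype A] [Fintype S] [Fintype X] [Fintype Y] [Fintype Z]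
  {M N : ℕ} (C : Code A S X Y M N) (ch : ActionChannel A S X Y Z)

omit [Fintype A] [Fintype X] in
lemma Q₀_mem : ch.Q₀ ∈ stdSimplex ℝ Z := by
  refine ⟨fun z => Finset.sum_nonneg fun s _ => mul_nonneg ((ch.Q_mem _).1 s)
    (Finset.sum_nonneg fun y _ => (ch.W_mem _ _).1 _), ?_⟩
  simp only [ActionChannel.Q₀]
  rw [Finset.sum_comm]
  simp only [← Finset.mul_sum]
  have : ∀ s, ∑ z, ∑ y, ch.W ch.x₀ s (y, z) = 1 := fun s => by
    rw [Finset.sum_comm, ← Fintype.sum_prod_type]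
    exact (ch.W_mem _ _).2
  simp only [this, mul_one]
  exact (ch.Q_mem _).2

/-- Covertness of the whole block controls the law of each of the warden's letters. -/
lemma abs_law_observation_sub_le (hM : 0 < M) (t : Fin N) (z : Z) {ε : ℝ}
    (hε : klDivergence (C.wardenLaw ch) (fun z => ∏ t, ch.Q₀ (z t)) ≤ (ε : ℝ)) :
    |law (C.joint ch) (fun ω => observations ω t) z - ch.Q₀ z| ≤ √(4 * (Real.log 2 * ε)) := by
  classical
  have hl2 : 0 < Real.log 2 := Real.log_pos (by norm_num)
  have hac : ∀ v : Fin N → Z, ∏ t, ch.Q₀ (v t) = 0 → C.wardenLaw ch v = 0 := by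
    by_contra h
    rw [klDivergence, if_neg h] at hε
    simp at hε
  rw [klDivergence, if_pos hac, EReal.coe_le_coe_iff] at hε
  have hP : C.wardenLaw ch ∈ stdSimplex ℝ (Fin N → Z) := by
    rw [wardenLaw_eq]
    exact ⟨law_nonneg (C.joint_nonneg ch) _, by rw [sum_law, sum_joint C ch hM]⟩
  have hQ : (fun v : Fin N → Z => ∏ t, ch.Q₀ (v t)) ∈ stdSimplex ℝ (Fin N → Z) :=
    ⟨fun v => Finset.prod_nonneg fun t _ => (Q₀_mem ch).1 _,
      sum_prod_eq_one (fun _ => ch.Q₀) (fun _ => (Q₀_mem ch).2)⟩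
  have h1 := sq_sum_abs_sub_le _ _ hP hQ hac
  have h2 : law (C.joint ch) (fun ω => observations ω t) z
      = ∑ v : Fin N → Z, if v t = z then C.wardenLaw ch v else 0 := by
    rw [wardenLaw_eq, law_comp (C.joint ch) observations (fun v => v t), law_apply]
  have h3 : ch.Q₀ z = ∑ v : Fin N → Z, if v t = z then ∏ t, ch.Q₀ (v t) else 0 := by
    have := sum_ite_mul_prod (N := N) (fun _ => ch.Q₀) t (Q₀_mem ch).2 (fun _ => 1)
      (fun _ _ _ => rfl) z
    simp only [one_mul] at this
    rw [this, sum_prod_eq_one (fun _ => ch.Q₀) (fun _ => (Q₀_mem ch).2), one_mul]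
  refine Real.le_sqrt_of_sq_le ?_
  refine le_trans ?_ (h1.trans (by gcongr))
  refine pow_le_pow_left₀ (abs_nonneg _) ?_ 2
  rw [h2, h3, ← Finset.sum_sub_distrib]
  refine (Finset.abs_sum_le_sum_abs _ _).trans (Finset.sum_le_sum fun v _ => ?_)
  split_ifs <;> simp

end Covertness

/-! ### Convex hulls in finite dimension -/

section ConvexHull

variable {E : Type*} [NormedAddCommGroup E] [NormedSpace ℝ E] [FiniteDimensional ℝ E] {s : Set E}

/-- Carathéodory's theorem with a fixed number of atoms. -/
lemma exists_fin_mixture {c : E} (hc : c ∈ convexHull ℝ s) :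
    ∃ w ∈ stdSimplex ℝ (Fin (Module.finrank ℝ E + 1)),
      ∃ z : Fin (Module.finrank ℝ E + 1) → E, (∀ i, z i ∈ s) ∧ ∑ i, w i • z i = c := by
  obtain ⟨ι, _, z, w, hz, haff, hw, hw1, hc⟩ := eq_pos_convex_span_of_mem_convexHull hc
  have hcard : Fintype.card ι ≤ Fintype.card (Fin (Module.finrank ℝ E + 1)) := by
    rw [Fintype.card_fin]
    exact haff.card_le_finrank_succ.trans (Nat.succ_le_succ (Submodule.finrank_le _))
  obtain ⟨e⟩ := Function.Embedding.nonempty_of_card_le hcard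
  have hι : Nonempty ι := by
    by_contra h
    rw [not_nonempty_iff] at h
    simp at hw1
  obtain ⟨i₀⟩ := hι
  have hw0 : ∀ j, j ∉ Set.range e → Function.extend e w 0 j = 0 := fun j hj => by
    rw [Function.extend_apply' _ _ _ (by simpa using hj)]; rfl
  refine ⟨Function.extend e w 0, ⟨fun j => ?_, ?_⟩, Function.extend e z fun _ => z i₀,
    fun j => ?_, ?_⟩
  · by_cases hj : j ∈ Set.range e
    · obtain ⟨i, rfl⟩ := hj
      rw [e.injective.extend_apply]
      exact (hw i).le
    · rw [hw0 j hj]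
  · rw [← hw1]
    exact (Fintype.sum_of_injective e e.injective _ _ hw0
      fun i => (e.injective.extend_apply _ _ _).symm).symm
  · by_cases hj : j ∈ Set.range e
    · obtain ⟨i, rfl⟩ := hj
      rw [e.injective.extend_apply]
      exact hz ⟨i, rfl⟩
    · rw [Function.extend_apply' _ _ _ (by simpa using hj)]
      exact hz ⟨i₀, rfl⟩
  · rw [← hc]
    refine (Fintype.sum_of_injective e e.injective _ _ (fun j hj => ?_) fun i => ?_).symm
    · rw [hw0 j hj, zero_smul]
    · rw [e.injective.extend_apply, e.injective.extend_apply]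

lemma isCompact_convexHull (hs : IsCompact s) : IsCompact (convexHull ℝ s) := by
  set m := Module.finrank ℝ E + 1
  have h : convexHull ℝ s = (fun q : (Fin m → ℝ) × (Fin m → E) => ∑ i, q.1 i • q.2 i) ''
      (stdSimplex ℝ (Fin m) ×ˢ Set.univ.pi fun _ => s) := by
    ext c
    constructor
    · intro hc
      obtain ⟨w, hw, z, hz, h⟩ := exists_fin_mixture hc
      exact ⟨(w, z), ⟨hw, fun i _ => hz i⟩, h⟩
    · rintro ⟨⟨w, z⟩, ⟨hw, hz⟩, rfl⟩
      exact (convex_convexHull ℝ s).sum_mem (fun i _ => hw.1 i) hw.2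
        fun i _ => subset_convexHull ℝ s (hz i trivial)
  rw [h]
  refine ((isCompact_stdSimplex ℝ _).prod (isCompact_univ_pi fun _ => hs)).image ?_
  fun_prop

end ConvexHull

/-! ### The limit of large block lengths -/

section Limit

open Filter Topology

variable {A S X Y Z : Type*} [Fintype A] [Fintype S] [Fintype X] [Fintype Y] [Fintype Z]
  (ch : ActionChannel A S X Y Z)

omit [Fintype A] in
lemma continuous_outputLaw : Continuous (outputLaw ch) :=
  continuous_pi fun y => by unfold outputLaw; fun_prop

omit [Fintype A] in
lemma continuous_observationLaw : Continuous (observationLaw ch) :=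
  continuous_pi fun y => by unfold observationLaw; fun_prop

omit [Fintype S] in
lemma continuous_stateLaw : Continuous (stateLaw : (S × X → ℝ) → S → ℝ) :=
  continuous_pi fun y => by unfold stateLaw; fun_prop

omit [Fintype S] [Fintype X] in
lemma continuous_stateInputLaw : Continuous (stateInputLaw : (A × S × X → ℝ) → S × X → ℝ) :=
  continuous_pi fun y => by unfold stateInputLaw; fun_prop

omit [Fintype A] in
lemma continuous_actionLaw (a : A) : Continuous fun μ : A × S × X → ℝ => actionLaw μ a := by
  unfold actionLaw; fun_prop

omit [Fintype A] in
lemma continuous_gain : Continuous (gain ch) :=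
  (continuous_shannon.comp continuous_stateLaw).sub
    (continuous_shannon.comp (continuous_outputLaw ch))

lemma continuous_mixtureRate : Continuous (mixtureRate ch) := by
  unfold mixtureRate
  refine ((continuous_shannon.comp ((continuous_outputLaw ch).comp
    (continuous_stateInputLaw.comp continuous_fst))).sub ?_).add continuous_snd
  exact continuous_finsetSum _ fun a _ =>
    ((continuous_actionLaw a).comp continuous_fst).mul continuous_const

omit [Fintype A] in
lemma isClosed_stateConsistent : IsClosed {μ | StateConsistent ch μ} := by
  simp only [StateConsistent, Set.ofPred_forall]
  refine isClosed_iInter fun a => isClosed_iInter fun s => isClosed_eq (by fun_prop) ?_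
  exact (continuous_actionLaw a).mul continuous_const

lemma isCompact_letterSet : IsCompact (letterSet ch) := by
  have h : letterSet ch = ⋃ a, (fun ν => (withAction a ν, gain ch ν)) '' stdSimplex ℝ (S × X) := by
    ext c
    simp only [letterSet, Set.mem_ofPred_eq, Set.mem_iUnion, Set.mem_image]
    exact exists_congr fun a => exists_congr fun ν => and_congr_right fun _ => eq_comm
  rw [h]
  refine isCompact_iUnion fun a => (isCompact_stdSimplex ℝ _).image ?_
  refine Continuous.prodMk (continuous_pi fun b => ?_) (continuous_gain ch)
  unfold withAction
  split_ifs <;> fun_prop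

/-- The number of messages, rounded down, loses at most one bit. -/
lemma sub_one_le_logb_floor {x : ℝ} (hx : 0 ≤ x) : x - 1 ≤ Real.logb 2 ⌊(2 : ℝ) ^ x⌋₊ := by
  have h1 : 1 ≤ (2 : ℝ) ^ x := Real.one_le_rpow (by norm_num) hx
  have h2 : (1 : ℝ) ≤ ⌊(2 : ℝ) ^ x⌋₊ := by exact_mod_cast Nat.floor_pos.2 h1
  have h3 := Nat.lt_floor_add_one ((2 : ℝ) ^ x)
  rw [Real.le_logb_iff_rpow_le (by norm_num) (by linarith), Real.rpow_sub_one (by norm_num)]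
  linarith

/-- An achievable covert rate is at most the rate of a mixture under which the warden observes
`Q₀`: a limit point of the mixtures that good codes give. -/
lemma exists_mixture_of_achievable {R : ℝ} (h : CovertAchievable ch R) :
    ∃ c ∈ convexHull ℝ (letterSet ch), StateConsistent ch c.1 ∧
      observationLaw ch (stateInputLaw c.1) = ch.Q₀ ∧ R ≤ mixtureRate ch c := by
  obtain ⟨hR, C, -, hPe, hKL⟩ := h
  have hM : ∀ N : ℕ, 0 < ⌊(2 : ℝ) ^ ((N : ℝ) * R)⌋₊ := fun N =>
    Nat.floor_pos.2 (Real.one_le_rpow (by norm_num) (by positivity))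
  have hex := fun n : ℕ => exists_mixture_of_code (C (n + 1)) ch (hM _) n.succ_pos
  choose c hc hcons hobs hrate using hex
  obtain ⟨c', hc', φ, hφ, hlim⟩ := (isCompact_convexHull (isCompact_letterSet ch)).tendsto_subseq hc
  have hφ' : Tendsto (fun n => φ n + 1) atTop atTop := (tendsto_add_atTop_nat 1).comp
    hφ.tendsto_atTop
  have hlim1 : Tendsto (fun n => (c (φ n)).1) atTop (𝓝 c'.1) :=
    (continuous_fst.tendsto _).comp hlim
  refine ⟨c', hc', ?_, ?_, ?_⟩
  · exact (isClosed_stateConsistent ch).mem_of_tendsto hlim1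
      (Eventually.of_forall fun n => hcons _)
  · funext z
    have h1 : Tendsto (fun n => observationLaw ch (stateInputLaw (c (φ n)).1) z) atTop
        (𝓝 (observationLaw ch (stateInputLaw c'.1) z)) :=
      (((continuous_apply z).comp ((continuous_observationLaw ch).comp
        continuous_stateInputLaw)).tendsto _).comp hlim1
    refine tendsto_nhds_unique h1 ?_
    set D : ℕ → EReal := fun N => klDivergence ((C N).wardenLaw ch) (fun z => ∏ t, ch.Q₀ (z t))
    have h2 : Tendsto (fun n => √(4 * (Real.log 2 * (D (φ n + 1)).toReal))) atTop (𝓝 0) := by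
      have h3 : Tendsto (fun n => (D (φ n + 1)).toReal) atTop (𝓝 0) := by
        have := (EReal.tendsto_toReal (a := 0) (by simp) (by simp)).comp (hKL.comp hφ')
        rw [EReal.toReal_zero] at this
        exact this
      have h4 : Continuous fun x : ℝ => √(4 * (Real.log 2 * x)) := by fun_prop
      have h5 := (h4.tendsto 0).comp h3
      rwa [mul_zero, mul_zero, Real.sqrt_zero] at h5
    have h5 : ∀ᶠ n in atTop, D (φ n + 1) ≠ ⊤ := by
      have : ∀ᶠ n in atTop, D (φ n + 1) < ⊤ :=
        (hKL.comp hφ').eventually (gt_mem_nhds (by simp))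
      exact this.mono fun n hn => hn.ne
    rw [tendsto_iff_dist_tendsto_zero]
    refine squeeze_zero' (Eventually.of_forall fun _ => dist_nonneg) (h5.mono fun n hn => ?_) h2
    have hN : (0 : ℝ) < ((φ n + 1 : ℕ) : ℝ) := by positivity
    rw [hobs, Real.dist_eq]
    have h6 := fun t => abs_law_observation_sub_le (C (φ n + 1)) ch (hM _) t z
      (EReal.le_coe_toReal hn)
    set δ := √(4 * (Real.log 2 * (D (φ n + 1)).toReal))
    have h7 : (∑ t, law ((C (φ n + 1)).joint ch) (fun ω => Transcript.observations ω t) z)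
          / ((φ n + 1 : ℕ) : ℝ) - ch.Q₀ z
        = (∑ t, (law ((C (φ n + 1)).joint ch) (fun ω => Transcript.observations ω t) z
          - ch.Q₀ z)) / ((φ n + 1 : ℕ) : ℝ) := by
      rw [Finset.sum_sub_distrib, sub_div]
      simp only [Finset.sum_const, Finset.card_univ, Fintype.card_fin, nsmul_eq_mul]
      field_simp
    rw [h7, abs_div, abs_of_pos hN, div_le_iff₀ hN]
    refine (Finset.abs_sum_le_sum_abs _ _).trans ((Finset.sum_le_sum fun t _ => h6 t).trans ?_)
    simp [mul_comm]
  · have h1 : Tendsto (fun n => mixtureRate ch (c (φ n))) atTop (𝓝 (mixtureRate ch c')) :=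
      ((continuous_mixtureRate ch).tendsto _).comp hlim
    have h2 : Tendsto (fun n => (1 - (C (φ n + 1)).errorProb ch) * (R - 1 / ((φ n + 1 : ℕ) : ℝ))
        - 1 / ((φ n + 1 : ℕ) : ℝ)) atTop (𝓝 ((1 - 0) * (R - 0) - 0)) := by
      have h3 : Tendsto (fun n => 1 / ((φ n + 1 : ℕ) : ℝ)) atTop (𝓝 0) :=
        tendsto_one_div_atTop_nhds_zero_nat.comp hφ'
      exact (((hPe.comp hφ').const_sub 1).mul (h3.const_sub R)).sub h3
    rw [sub_zero, sub_zero, sub_zero, one_mul] at h2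
    have h4 : ∀ᶠ n in atTop, (C (φ n + 1)).errorProb ch < 1 :=
      (hPe.comp hφ').eventually (gt_mem_nhds one_pos)
    refine le_of_tendsto_of_tendsto h2 h1 (h4.mono fun n hn => le_trans ?_ (hrate (φ n)))
    have hN : (0 : ℝ) < ((φ n + 1 : ℕ) : ℝ) := by positivity
    have h5 := sub_one_le_logb_floor (x := ((φ n + 1 : ℕ) : ℝ) * R) (by positivity)
    have h6 := mul_le_mul_of_nonneg_left h5 (sub_nonneg.2 hn.le)
    rw [le_div_iff₀ hN]
    calc _ = (1 - (C (φ n + 1)).errorProb ch) * (((φ n + 1 : ℕ) : ℝ) * R - 1) - 1 := by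
          field_simp
      _ ≤ _ := by linarith

end Limit

/-! ### The joint law of a mixture -/

section MixtureLaw

open Sample

variable {A S X Y Z γ : Type*} [Fintype A] [Fintype S] [Fintype X] [Fintype Y] [Fintype Z]
  {m n : ℕ} (ch : ActionChannel A S X Y Z) {w : Fin m → ℝ} {α : Fin m → A}
  {ν : Fin m → S × X → ℝ} {κ : Fin m → Fin n → ℝ}

open Classical in
/-- The joint law of `(A, S, U, V, X, Y, Z)` in which `U` has the law `w` and determines the action
`α U`, the state and the input have the law `ν u` given `U = u`, and `V` is produced from `U` alone
by the channel `κ`. -/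
noncomputable def mixtureLaw (w : Fin m → ℝ) (α : Fin m → A) (ν : Fin m → S × X → ℝ)
    (κ : Fin m → Fin n → ℝ) : Sample A S (Fin m) (Fin n) X Y Z → ℝ :=
  fun (a, s, u, v, x, y, z) =>
    if α u = a then w u * ν u (s, x) * κ u v * ch.W x s (y, z) else 0

lemma sum_mixtureLaw_mul (F : Sample A S (Fin m) (Fin n) X Y Z → ℝ) :
    ∑ ω, mixtureLaw ch w α ν κ ω * F ω
      = ∑ u, ∑ r, ∑ b, ∑ v, w u * ν u r * ch.W r.2 r.1 b * κ u v
        * F (α u, r.1, u, v, r.2, b.1, b.2) := by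
  classical
  simp only [Fintype.sum_prod_type, mixtureLaw, ite_mul, zero_mul]
  rw [Finset.sum_comm, Finset.sum_congr rfl fun s _ => Finset.sum_comm, Finset.sum_comm]
  refine Finset.sum_congr rfl fun u _ => Finset.sum_congr rfl fun s _ => ?_
  rw [Finset.sum_eq_single (α u) (fun a _ h => by simp [h.symm]) (by simp)]
  simp only [if_true]
  rw [Finset.sum_comm]
  refine Finset.sum_congr rfl fun x _ => ?_
  rw [Finset.sum_comm]
  refine Finset.sum_congr rfl fun y _ => ?_
  rw [Finset.sum_comm]
  exact Finset.sum_congr rfl fun z _ => Finset.sum_congr rfl fun v _ => by ring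

lemma law_mixtureLaw [DecidableEq γ] (f : Sample A S (Fin m) (Fin n) X Y Z → γ) (c : γ) :
    law (mixtureLaw ch w α ν κ) f c
      = ∑ u, ∑ r, ∑ b, ∑ v, if f (α u, r.1, u, v, r.2, b.1, b.2) = c
        then w u * ν u r * ch.W r.2 r.1 b * κ u v else 0 := by
  rw [law_apply]
  have := sum_mixtureLaw_mul ch (w := w) (α := α) (ν := ν) (κ := κ)
    (fun ω => if f ω = c then 1 else 0)
  simpa only [mul_ite, mul_one, mul_zero] using this

omit [Fintype A] in
lemma mixtureLaw_nonneg (hw : w ∈ stdSimplex ℝ (Fin m)) (hν : ∀ u, ν u ∈ stdSimplex ℝ (S × X))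
    (hκ : ∀ u, κ u ∈ stdSimplex ℝ (Fin n)) (ω) : 0 ≤ mixtureLaw ch w α ν κ ω := by
  obtain ⟨a, s, u, v, x, y, z⟩ := ω
  simp only [mixtureLaw]
  split_ifs
  · exact mul_nonneg (mul_nonneg (mul_nonneg (hw.1 u) ((hν u).1 _)) ((hκ u).1 _))
      ((ch.W_mem _ _).1 _)
  · exact le_rfl

lemma sum_mixtureLaw (hw : w ∈ stdSimplex ℝ (Fin m)) (hν : ∀ u, ν u ∈ stdSimplex ℝ (S × X))
    (hκ : ∀ u, κ u ∈ stdSimplex ℝ (Fin n)) : ∑ ω, mixtureLaw ch w α ν κ ω = 1 := by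
  have := sum_mixtureLaw_mul ch (w := w) (α := α) (ν := ν) (κ := κ) 1
  simp only [Pi.one_apply, mul_one, ← Finset.mul_sum, (hκ _).2, (ch.W_mem _ _).2, (hν _).2,
    hw.2] at this
  exact this

lemma law_mixtureLaw_U_SX (hκ : ∀ u, κ u ∈ stdSimplex ℝ (Fin n)) (u : Fin m) (r : S × X) :
    law (mixtureLaw ch w α ν κ) (fun ω => (rvU ω, (rvS ω, rvX ω))) (u, r) = w u * ν u r := by
  classical
  rw [law_mixtureLaw]
  simp only [Prod.mk.eta, Prod.mk.injEq]
  rw [Finset.sum_eq_single u (fun u' _ h => by simp [h]) (by simp),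
    Finset.sum_eq_single r (fun r' _ h => by simp [h]) (by simp)]
  simp only [and_self, if_true, ← Finset.mul_sum, (hκ _).2, (ch.W_mem _ _).2, mul_one]

lemma law_mixtureLaw_U (hν : ∀ u, ν u ∈ stdSimplex ℝ (S × X))
    (hκ : ∀ u, κ u ∈ stdSimplex ℝ (Fin n)) (u : Fin m) :
    law (mixtureLaw ch w α ν κ) rvU u = w u := by
  rw [← sum_law_prod_right (mixtureLaw ch w α ν κ) rvU (fun ω => (rvS ω, rvX ω))]
  simp only [law_mixtureLaw_U_SX ch hκ, ← Finset.mul_sum, (hν u).2, mul_one]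

lemma law_mixtureLaw_ASX (hκ : ∀ u, κ u ∈ stdSimplex ℝ (Fin n)) :
    law (mixtureLaw ch w α ν κ) (fun ω => (rvA ω, rvS ω, rvX ω))
      = ∑ u, w u • withAction (α u) (ν u) := by
  classical
  funext ⟨a, r⟩
  rw [law_mixtureLaw, Finset.sum_apply]
  refine Finset.sum_congr rfl fun u _ => ?_
  rw [Finset.sum_eq_single r (fun r' _ h => by
    simp only [Prod.mk.injEq]
    refine Finset.sum_eq_zero fun b _ => Finset.sum_eq_zero fun v _ => if_neg ?_
    rintro ⟨-, h1⟩
    exact h h1) (by simp)]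
  simp only [Prod.mk.eta, Prod.mk.injEq, and_true, Pi.smul_apply, smul_eq_mul, withAction, mul_ite,
    mul_zero]
  split_ifs
  · simp only [← Finset.mul_sum, (hκ _).2, (ch.W_mem _ _).2, mul_one]
  · simp

/-- `V - U - (A, S, X, Y, Z)` is a Markov chain: the law of `V` is `κ u` whatever is known of the
other variables, as long as `u` is. -/
lemma law_mixtureLaw_V (hκ : ∀ u, κ u ∈ stdSimplex ℝ (Fin n))
    (Φ : Sample A S (Fin m) (Fin n) X Y Z → γ) (φ : γ → Fin m) (hφ : ∀ ω, φ (Φ ω) = rvU ω)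
    (hΦ : ∀ a s u v v' x y z, Φ (a, s, u, v, x, y, z) = Φ (a, s, u, v', x, y, z))
    (c : γ) (v : Fin n) :
    law (mixtureLaw ch w α ν κ) (fun ω => (Φ ω, rvV ω)) (c, v)
      = law (mixtureLaw ch w α ν κ) Φ c * κ (φ c) v := by
  classical
  rw [law_mixtureLaw, law_mixtureLaw]
  simp only [Finset.sum_mul]
  refine Finset.sum_congr rfl fun u _ => Finset.sum_congr rfl fun r _ =>
    Finset.sum_congr rfl fun b _ => ?_
  simp only [Prod.mk.injEq]
  rw [Finset.sum_eq_single v (fun v' _ h => by simp [h]) (by simp)]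
  have h1 : ∀ v', Φ (α u, r.1, u, v', r.2, b.1, b.2) = Φ (α u, r.1, u, v, r.2, b.1, b.2) :=
    fun v' => hΦ _ _ _ _ _ _ _ _
  simp only [h1, and_true]
  by_cases h : Φ (α u, r.1, u, v, r.2, b.1, b.2) = c
  · have h2 : φ c = u := by rw [← h, hφ]
    simp only [h, if_true, h2, ← Finset.mul_sum, ← Finset.sum_mul, (hκ u).2, mul_one]
  · simp [h]

lemma law_mixtureLaw_YZ (Φ : Sample A S (Fin m) (Fin n) X Y Z → γ) (φ : γ → S × X)
    (hφ : ∀ ω, φ (Φ ω) = (rvS ω, rvX ω))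
    (hΦ : ∀ a s u v x y z y' z', Φ (a, s, u, v, x, y, z) = Φ (a, s, u, v, x, y', z'))
    (c : γ) (b : Y × Z) :
    law (mixtureLaw ch w α ν κ) (fun ω => (Φ ω, (rvY ω, rvZ ω))) (c, b)
      = law (mixtureLaw ch w α ν κ) Φ c * ch.W (φ c).2 (φ c).1 b := by
  classical
  rw [law_mixtureLaw, law_mixtureLaw]
  simp only [Finset.sum_mul]
  refine Finset.sum_congr rfl fun u _ => Finset.sum_congr rfl fun r _ => ?_
  rw [Finset.sum_comm, Finset.sum_comm (s := (Finset.univ : Finset (Y × Z)))]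
  refine Finset.sum_congr rfl fun v _ => ?_
  simp only [Prod.mk.eta, Prod.mk.injEq]
  rw [Finset.sum_eq_single b (fun b' _ h => by simp [h]) (by simp)]
  have h1 : ∀ b' : Y × Z, Φ (α u, r.1, u, v, r.2, b'.1, b'.2) = Φ (α u, r.1, u, v, r.2, b.1, b.2) :=
    fun v' => hΦ _ _ _ _ _ _ _ _ _
  simp only [h1, and_true]
  by_cases h : Φ (α u, r.1, u, v, r.2, b.1, b.2) = c
  · have h2 : φ c = r := by rw [← h, hφ]
    simp only [h, if_true, h2, ← Finset.mul_sum, ← Finset.sum_mul, (ch.W_mem _ _).2, mul_one]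
    ring
  · simp [h]

/-- The pair `(P_{ASX}, H(S|U) - H(Y|U))` that the atoms `(α u, ν u)` with the weights `w u`
make. -/
noncomputable def mixture (w : Fin m → ℝ) (α : Fin m → A) (ν : Fin m → S × X → ℝ) :
    (A × S × X → ℝ) × ℝ :=
  ∑ u, w u • (withAction (α u) (ν u), gain ch (ν u))

omit [Fintype A] in
lemma mixture_fst : (mixture ch w α ν).1 = ∑ u, w u • withAction (α u) (ν u) := by
  simp only [mixture, Prod.fst_sum, Prod.smul_fst]

omit [Fintype A] in
lemma mixture_snd : (mixture ch w α ν).2 = ∑ u, w u * gain ch (ν u) := by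
  simp only [mixture, Prod.snd_sum, Prod.smul_snd, smul_eq_mul]

omit [Fintype A] [Fintype S] in
lemma sum_withAction [DecidableEq A] (a : A) (s : S) :
    ∑ x, (∑ u, w u • withAction (α u) (ν u)) (a, s, x)
      = ∑ u, if α u = a then w u * stateLaw (ν u) s else 0 := by
  simp only [Finset.sum_apply, Pi.smul_apply, smul_eq_mul, withAction, stateLaw]
  rw [Finset.sum_comm]
  refine Finset.sum_congr rfl fun u _ => ?_
  split_ifs <;> simp [Finset.mul_sum]

lemma factorizes_mixtureLaw (hw : w ∈ stdSimplex ℝ (Fin m))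
    (hν : ∀ u, ν u ∈ stdSimplex ℝ (S × X)) (hκ : ∀ u, κ u ∈ stdSimplex ℝ (Fin n))
    (hcons : StateConsistent ch (mixture ch w α ν).1) :
    Factorizes ch (mixtureLaw ch w α ν κ) := by
  classical
  set PA := actionLaw (mixture ch w α ν).1
  set J : A → S → Fin m → ℝ := fun a s u => if α u = a then w u * stateLaw (ν u) s else 0 with hJ
  have hJsum : ∀ a s, ∑ u, J a s u = PA a * ch.Q a s := fun a s => by
    rw [← hcons a s, mixture_fst, sum_withAction]
  have hsL : ∀ u s, 0 ≤ stateLaw (ν u) s := fun u s => Finset.sum_nonneg fun x _ => (hν u).1 _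
  have hJ0 : ∀ a s u, 0 ≤ J a s u := fun a s u => by
    simp only [hJ]
    split_ifs
    · exact mul_nonneg (hw.1 u) (hsL u s)
    · exact le_rfl
  have hPA1 : ∀ a, ∑ s, PA a * ch.Q a s = PA a := fun a => by
    rw [← Finset.mul_sum, (ch.Q_mem a).2, mul_one]
  -- `P_{U|AS}` and `P_{X|US}` are quotients; their rows at null events are arbitrary laws
  refine ⟨PA, fun a s u => if PA a * ch.Q a s = 0 then w u else J a s u / (PA a * ch.Q a s),
    fun u _ => κ u, fun u s x => if stateLaw (ν u) s = 0 then (if x = ch.x₀ then 1 else 0)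
      else ν u (s, x) / stateLaw (ν u) s, ⟨fun a => ?_, ?_⟩, fun a s => ⟨fun u => ?_, ?_⟩,
    fun u _ => hκ u, fun u s => ⟨fun x => ?_, ?_⟩, fun a s u v x y z => ?_⟩
  · rw [← hPA1]
    exact Finset.sum_nonneg fun s _ => by rw [← hJsum]; exact Finset.sum_nonneg fun u _ => hJ0 a s u
  · have h1 : ∑ a, PA a = ∑ u, ∑ s, w u * stateLaw (ν u) s := by
      calc ∑ a, PA a = ∑ a, ∑ s, ∑ u, J a s u :=
            Finset.sum_congr rfl fun a _ => by
              rw [← hPA1 a]; exact Finset.sum_congr rfl fun s _ => (hJsum a s).symm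
        _ = ∑ u, ∑ s, ∑ a, J a s u := by
            rw [Finset.sum_comm, Finset.sum_congr rfl fun s _ => Finset.sum_comm, Finset.sum_comm]
        _ = _ := by simp [hJ]
    rw [h1, ← hw.2]
    refine Finset.sum_congr rfl fun u _ => ?_
    have h2 := (hν u).2
    rw [Fintype.sum_prod_type] at h2
    simp only [stateLaw, ← Finset.mul_sum, h2, mul_one]
  · dsimp only
    split_ifs
    · exact hw.1 u
    · refine div_nonneg (hJ0 a s u) ?_
      rw [← hJsum]
      exact Finset.sum_nonneg fun u _ => hJ0 a s u
  · dsimp only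
    split_ifs with h
    · exact hw.2
    · rw [← Finset.sum_div, hJsum, div_self h]
  · dsimp only
    split_ifs
    · norm_num
    · norm_num
    · exact div_nonneg ((hν u).1 _) (hsL u s)
  · dsimp only
    split_ifs with h
    · simp
    · rw [← Finset.sum_div]
      exact div_self h
  · have h1 : PA a * ch.Q a s * (if PA a * ch.Q a s = 0 then w u
        else J a s u / (PA a * ch.Q a s)) = J a s u := by
      split_ifs with h
      · rw [h, zero_mul]
        have := hJsum a s
        rw [h, Finset.sum_eq_zero_iff_of_nonneg fun u _ => hJ0 a s u] at this
        exact (this u (Finset.mem_univ u)).symm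
      · rw [mul_div_cancel₀ _ h]
    have h2 : stateLaw (ν u) s * (if stateLaw (ν u) s = 0 then (if x = ch.x₀ then 1 else 0)
        else ν u (s, x) / stateLaw (ν u) s) = ν u (s, x) := by
      split_ifs with h h'
      · rw [h, zero_mul]
        rw [stateLaw, Finset.sum_eq_zero_iff_of_nonneg fun x _ => (hν u).1 _] at h
        exact (h x (Finset.mem_univ x)).symm
      · rw [h, zero_mul]
        rw [stateLaw, Finset.sum_eq_zero_iff_of_nonneg fun x _ => (hν u).1 _] at h
        exact (h x (Finset.mem_univ x)).symm
      · rw [mul_div_cancel₀ _ h]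
    dsimp only
    rw [h1]
    simp only [mixtureLaw, hJ]
    by_cases h : α u = a
    · rw [if_pos h, if_pos h]
      nth_rw 1 [← h2]
      ring
    · simp [h]

end MixtureLaw

/-! ### The rates of a mixture -/

section Rates

open Sample

variable {A S X Y Z : Type*} [Fintype A] [Fintype S] [Fintype X] [Fintype Y] [Fintype Z]
  {m n : ℕ} (ch : ActionChannel A S X Y Z) {w : Fin m → ℝ} {α : Fin m → A}
  {ν : Fin m → S × X → ℝ} {κ : Fin m → Fin n → ℝ}

lemma stateInputLaw_mixture (hκ : ∀ u, κ u ∈ stdSimplex ℝ (Fin n)) :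
    stateInputLaw (mixture ch w α ν).1
      = law (mixtureLaw ch w α ν κ) (fun ω => (rvS ω, rvX ω)) := by
  rw [mixture_fst, ← law_mixtureLaw_ASX ch hκ]
  funext r
  exact sum_law_prod_left (mixtureLaw ch w α ν κ) rvA (fun ω => (rvS ω, rvX ω)) r

lemma actionLaw_mixture (hκ : ∀ u, κ u ∈ stdSimplex ℝ (Fin n)) :
    actionLaw (mixture ch w α ν).1 = law (mixtureLaw ch w α ν κ) rvA := by
  rw [mixture_fst, ← law_mixtureLaw_ASX ch hκ]
  funext a
  exact sum_law_prod_right (mixtureLaw ch w α ν κ) rvA (fun ω => (rvS ω, rvX ω)) a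

lemma law_mixtureLaw_SX_YZ (r : S × X) (b : Y × Z) :
    law (mixtureLaw ch w α ν κ) (fun ω => ((rvS ω, rvX ω), (rvY ω, rvZ ω))) (r, b)
      = law (mixtureLaw ch w α ν κ) (fun ω => (rvS ω, rvX ω)) r * ch.W r.2 r.1 b :=
  law_mixtureLaw_YZ ch (fun ω => (rvS ω, rvX ω)) id (fun _ => rfl)
    (fun _ _ _ _ _ _ _ _ _ => rfl) r b

lemma law_mixtureLaw_Z (hκ : ∀ u, κ u ∈ stdSimplex ℝ (Fin n)) :
    law (mixtureLaw ch w α ν κ) rvZ = observationLaw ch (stateInputLaw (mixture ch w α ν).1) := by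
  rw [stateInputLaw_mixture ch hκ]
  exact law_observation_of_memoryless ch (law_mixtureLaw_SX_YZ ch)

lemma law_mixtureLaw_Y (hκ : ∀ u, κ u ∈ stdSimplex ℝ (Fin n)) :
    law (mixtureLaw ch w α ν κ) rvY = outputLaw ch (stateInputLaw (mixture ch w α ν).1) := by
  rw [stateInputLaw_mixture ch hκ]
  exact law_receiver_of_memoryless ch (law_mixtureLaw_SX_YZ ch)

lemma law_mixtureLaw_AS (hκ : ∀ u, κ u ∈ stdSimplex ℝ (Fin n))
    (hcons : StateConsistent ch (mixture ch w α ν).1) (a : A) (s : S) :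
    law (mixtureLaw ch w α ν κ) (fun ω => (rvA ω, rvS ω)) (a, s)
      = law (mixtureLaw ch w α ν κ) rvA a * ch.Q a s := by
  classical
  rw [← actionLaw_mixture ch hκ, ← hcons a s, mixture_fst, ← law_mixtureLaw_ASX ch hκ,
    ← sum_law_prod_right (mixtureLaw ch w α ν κ) (fun ω => (rvA ω, rvS ω)) rvX (a, s)]
  simp only [law_apply, Prod.mk.injEq, and_assoc]

omit [Fintype A] [Fintype X] in
lemma action_eq_of_pos (ω : Sample A S (Fin m) (Fin n) X Y Z)
    (h : 0 < mixtureLaw ch w α ν κ ω) : α (rvU ω) = rvA ω := by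
  obtain ⟨a, s, u, v, x, y, z⟩ := ω
  by_contra h'
  change ¬ α u = a at h'
  simp [mixtureLaw, h'] at h

lemma rate₁_mixtureLaw (hw : w ∈ stdSimplex ℝ (Fin m)) (hν : ∀ u, ν u ∈ stdSimplex ℝ (S × X))
    (hκ : ∀ u, κ u ∈ stdSimplex ℝ (Fin n)) (hcons : StateConsistent ch (mixture ch w α ν).1) :
    rate₁ (mixtureLaw ch w α ν κ) = mixtureRate ch (mixture ch w α ν) := by
  have hp := mixtureLaw_nonneg ch (α := α) hw hν hκ
  set P := mixtureLaw ch w α ν κ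
  have hact := action_eq_of_pos ch (w := w) (α := α) (ν := ν) (κ := κ)
  have h1 : entropy P (fun ω => (rvU ω, rvA ω)) = entropy P rvU := by
    refine le_antisymm ?_ ?_ <;> refine entropy_le_of_determines hp fun ω ω' h h' he => ?_
    · rw [← hact ω h, ← hact ω' h', he]
    · exact (Prod.mk.inj he).1
  have h2 : entropy P (fun ω => (rvU ω, rvS ω, rvA ω)) = entropy P (fun ω => (rvU ω, rvS ω)) := by
    refine le_antisymm ?_ ?_ <;> refine entropy_le_of_determines hp fun ω ω' h h' he => ?_
    · rw [← hact ω h, ← hact ω' h', (Prod.mk.inj he).1, (Prod.mk.inj he).2]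
    · simp only [Prod.mk.injEq] at he ⊢
      tauto
  have h3 : entropy P (fun ω => (rvS ω, rvA ω))
      = entropy P rvA + ∑ a, law P rvA a * shannon (ch.Q a) := by
    rw [← entropy_prod_of_kernel (law_mixtureLaw_AS ch hκ hcons)]
    exact entropy_congr hp fun ω ω' => by simp only [Prod.mk.injEq]; tauto
  have h4 : entropy P (fun ω => (rvU ω, rvS ω)) - entropy P (fun ω => (rvU ω, rvY ω))
      = ∑ u, law P rvU u * gain ch (ν u) := by
    refine entropy_sub_eq_sum_gain ch (Xv := rvX) (Zv := rvZ)
      (fun u r => ?_) (fun u r b => ?_)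
    · rw [law_mixtureLaw_U_SX ch hκ, law_mixtureLaw_U ch hν hκ]
    · exact law_mixtureLaw_YZ ch (fun ω => (rvU ω, (rvS ω, rvX ω))) Prod.snd (fun _ => rfl)
        (fun _ _ _ _ _ _ _ _ _ => rfl) (u, r) b
  have h5 : entropy P rvY = shannon (outputLaw ch (stateInputLaw (mixture ch w α ν).1)) := by
    rw [entropy_eq_shannon, law_mixtureLaw_Y ch hκ]
  have h6 : ∀ u, law P rvU u = w u := law_mixtureLaw_U ch hν hκ
  simp only [h6] at h4
  rw [rate₁, mutualInfo, condMutualInfo, mixtureRate, mixture_snd, actionLaw_mixture ch hκ, h1, h2,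
    h3, ← h5, ← h4]
  ring

lemma rate₁_le_shannon (hw : w ∈ stdSimplex ℝ (Fin m)) (hν : ∀ u, ν u ∈ stdSimplex ℝ (S × X))
    (hκ : ∀ u, κ u ∈ stdSimplex ℝ (Fin n)) :
    rate₁ (mixtureLaw ch w α ν κ) ≤ shannon w := by
  have hp := mixtureLaw_nonneg ch (α := α) hw hν hκ
  have hp1 := sum_mixtureLaw ch (α := α) hw hν hκ
  set P := mixtureLaw ch w α ν κ
  have h1 := condMutualInfo_nonneg hp hp1 rvU rvS rvA
  have h2 : entropy P rvY ≤ entropy P (fun ω => (rvU ω, rvY ω)) :=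
    entropy_le_of_determines hp fun ω ω' _ _ he => (Prod.mk.inj he).2
  have h3 : entropy P rvU = shannon w := by
    rw [entropy_eq_shannon]
    exact congrArg _ (funext fun u => law_mixtureLaw_U ch hν hκ u)
  rw [rate₁, mutualInfo, h3]
  linarith

/-- `H(V | Φ) = H(V | U)` for all variables `Φ` other than `V` that determine `U`. -/
lemma entropy_mixtureLaw_V {γ : Type*} [Fintype γ] (hν : ∀ u, ν u ∈ stdSimplex ℝ (S × X))
    (hκ : ∀ u, κ u ∈ stdSimplex ℝ (Fin n))
    (Φ : Sample A S (Fin m) (Fin n) X Y Z → γ) (φ : γ → Fin m) (hφ : ∀ ω, φ (Φ ω) = rvU ω)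
    (hΦ : ∀ a s u v v' x y z, Φ (a, s, u, v, x, y, z) = Φ (a, s, u, v', x, y, z)) :
    entropy (mixtureLaw ch w α ν κ) (fun ω => (Φ ω, rvV ω))
      = entropy (mixtureLaw ch w α ν κ) Φ + ∑ u, w u * shannon (κ u) := by
  rw [entropy_prod_of_kernel (law_mixtureLaw_V ch hκ Φ φ hφ hΦ),
    sum_law_mul (mixtureLaw ch w α ν κ) Φ (fun c => shannon (κ (φ c)))]
  simp only [hφ]
  rw [← sum_law_mul (mixtureLaw ch w α ν κ) rvU (fun u => shannon (κ u))]
  simp only [law_mixtureLaw_U ch hν hκ]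

lemma rate₁_le_rate₂ (hw : w ∈ stdSimplex ℝ (Fin m)) (hν : ∀ u, ν u ∈ stdSimplex ℝ (S × X))
    (hκ : ∀ u, κ u ∈ stdSimplex ℝ (Fin n)) :
    rate₁ (mixtureLaw ch w α ν κ) ≤ rate₂ (mixtureLaw ch w α ν κ) := by
  have hp := mixtureLaw_nonneg ch (α := α) hw hν hκ
  have hp1 := sum_mixtureLaw ch (α := α) hw hν hκ
  have h1 := entropy_mixtureLaw_V ch (w := w) (α := α) hν hκ (fun ω => (rvU ω, rvA ω)) Prod.fst
    (fun _ => rfl) (fun _ _ _ _ _ _ _ _ => rfl)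
  have h2 := entropy_mixtureLaw_V ch (w := w) (α := α) hν hκ (fun ω => (rvU ω, rvS ω, rvA ω))
    Prod.fst (fun _ => rfl) (fun _ _ _ _ _ _ _ _ => rfl)
  set P := mixtureLaw ch w α ν κ
  have h3 := condMutualInfo_nonneg hp hp1 rvV rvY rvU
  have h4 := condMutualInfo_nonneg hp hp1 rvS rvV rvA
  have e1 : entropy P (fun ω => ((rvU ω, rvA ω), rvV ω))
      = entropy P (fun ω => (rvU ω, rvV ω, rvA ω)) :=
    entropy_congr hp fun ω ω' => by simp only [Prod.mk.injEq]; tauto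
  have e2 : entropy P (fun ω => ((rvU ω, rvS ω, rvA ω), rvV ω))
      = entropy P (fun ω => (rvU ω, rvS ω, rvV ω, rvA ω)) :=
    entropy_congr hp fun ω ω' => by simp only [Prod.mk.injEq]; tauto
  have e3 : entropy P (fun ω => (rvV ω, rvU ω)) = entropy P (fun ω => (rvU ω, rvV ω)) :=
    entropy_congr hp fun ω ω' => by simp only [Prod.mk.injEq]; tauto
  have e4 : entropy P (fun ω => (rvY ω, rvU ω)) = entropy P (fun ω => (rvU ω, rvY ω)) :=
    entropy_congr hp fun ω ω' => by simp only [Prod.mk.injEq]; tauto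
  have e5 : entropy P (fun ω => (rvV ω, rvY ω, rvU ω))
      = entropy P (fun ω => ((rvU ω, rvV ω), rvY ω)) :=
    entropy_congr hp fun ω ω' => by simp only [Prod.mk.injEq]; tauto
  rw [condMutualInfo] at h3 h4
  rw [e1] at h1
  rw [e2] at h2
  rw [e3, e4, e5] at h3
  rw [rate₁, rate₂, mutualInfo, mutualInfo, condMutualInfo, condMutualInfo]
  linarith

lemma rate₃_mixtureLaw (hw : w ∈ stdSimplex ℝ (Fin m)) (hν : ∀ u, ν u ∈ stdSimplex ℝ (S × X))
    (hκ : ∀ u, κ u ∈ stdSimplex ℝ (Fin n)) :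
    rate₃ (mixtureLaw ch w α ν κ)
      = entropy (mixtureLaw ch w α ν κ) rvV - ∑ u, w u * shannon (κ u) := by
  have hp := mixtureLaw_nonneg ch (α := α) hw hν hκ
  have h1 := entropy_mixtureLaw_V ch (w := w) (α := α) hν hκ (fun ω => (rvA ω, rvU ω, rvY ω))
    (fun c => c.2.1) (fun _ => rfl) (fun _ _ _ _ _ _ _ _ => rfl)
  set P := mixtureLaw ch w α ν κ
  have e1 : entropy P (fun ω => ((rvA ω, rvU ω, rvY ω), rvV ω))
      = entropy P (fun ω => (rvV ω, rvA ω, rvU ω, rvY ω)) :=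
    entropy_congr hp fun ω ω' => by simp only [Prod.mk.injEq]; tauto
  rw [e1] at h1
  rw [rate₃, mutualInfo]
  linarith

/-- The data processing inequality `I(V;Z) ≤ I(V;U)`; and `I(V;U)` is `I(V;A,U,Y)`. -/
lemma resolvability_le_rate₃ (hw : w ∈ stdSimplex ℝ (Fin m))
    (hν : ∀ u, ν u ∈ stdSimplex ℝ (S × X)) (hκ : ∀ u, κ u ∈ stdSimplex ℝ (Fin n)) :
    resolvability (mixtureLaw ch w α ν κ) ≤ rate₃ (mixtureLaw ch w α ν κ) := by
  have hp := mixtureLaw_nonneg ch (α := α) hw hν hκ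
  have hp1 := sum_mixtureLaw ch (α := α) hw hν hκ
  rw [rate₃_mixtureLaw ch hw hν hκ]
  have h1 := entropy_mixtureLaw_V ch (w := w) (α := α) hν hκ (fun ω => (rvU ω, rvZ ω)) Prod.fst
    (fun _ => rfl) (fun _ _ _ _ _ _ _ _ => rfl)
  set P := mixtureLaw ch w α ν κ
  have h2 := condMutualInfo_nonneg hp hp1 rvV rvU rvZ
  have h3 := mutualInfo_nonneg hp hp1 rvV rvS
  have e1 : entropy P (fun ω => ((rvU ω, rvZ ω), rvV ω))
      = entropy P (fun ω => (rvV ω, rvU ω, rvZ ω)) :=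
    entropy_congr hp fun ω ω' => by simp only [Prod.mk.injEq]; tauto
  rw [e1] at h1
  rw [condMutualInfo] at h2
  rw [resolvability]
  rw [mutualInfo] at h3 ⊢
  rw [mutualInfo]
  linarith

end Rates

/-! ### The erasure channel and the upper region -/

section Erasure

open Sample

variable {A S X Y Z : Type*} [Fintype A] [Fintype S] [Fintype X] [Fintype Y] [Fintype Z]
  {m : ℕ} (ch : ActionChannel A S X Y Z) {w : Fin m → ℝ} {α : Fin m → A}
  {ν : Fin m → S × X → ℝ} {l : ℝ}

/-- The erasure channel that lets its input through with probability `l`, and otherwise puts out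
the erasure symbol `Fin.last m`. -/
def erasure (m : ℕ) (l : ℝ) (u : Fin m) : Fin (m + 1) → ℝ :=
  Fin.snoc (α := fun _ => ℝ) (fun u' => if u = u' then l else 0) (1 - l)

lemma erasure_mem (h0 : 0 ≤ l) (h1 : l ≤ 1) (u : Fin m) :
    erasure m l u ∈ stdSimplex ℝ (Fin (m + 1)) := by
  refine ⟨fun v => ?_, ?_⟩
  · induction v using Fin.lastCases with
    | last => simpa [erasure] using h1
    | cast v => simp only [erasure, Fin.snoc_castSucc]; split_ifs <;> simp [h0]
  · simp [erasure, Fin.sum_univ_castSucc]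

lemma shannon_erasure (u : Fin m) :
    shannon (erasure m l u) = (Real.negMulLog l + Real.negMulLog (1 - l)) / Real.log 2 := by
  simp only [shannon, erasure, Fin.sum_univ_castSucc, Fin.snoc_castSucc, Fin.snoc_last]
  congr 2
  rw [Finset.sum_eq_single u (fun u' _ h => by simp [h.symm]) (by simp)]
  simp

/-- Through the erasure channel, `I(V;A,U,Y) = I(V;U)` is the fraction `l` of `H(U)`. -/
lemma rate₃_erasure (hw : w ∈ stdSimplex ℝ (Fin m)) (hν : ∀ u, ν u ∈ stdSimplex ℝ (S × X))
    (h0 : 0 ≤ l) (h1 : l ≤ 1) :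
    rate₃ (mixtureLaw ch w α ν (erasure m l)) = l * shannon w := by
  have hκ := erasure_mem (m := m) h0 h1
  rw [rate₃_mixtureLaw ch hw hν hκ]
  have hV : ∀ v, law (mixtureLaw ch w α ν (erasure m l)) rvV v = ∑ u, w u * erasure m l u v := by
    intro v
    rw [← sum_law_prod_left (mixtureLaw ch w α ν (erasure m l)) rvU rvV v]
    refine Finset.sum_congr rfl fun u _ => ?_
    rw [law_mixtureLaw_V ch hκ rvU id (fun _ => rfl) (fun _ _ _ _ _ _ _ _ => rfl),
      law_mixtureLaw_U ch hν hκ]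
    rfl
  have hc : ∀ u : Fin m, ∑ u', w u' * erasure m l u' u.castSucc = l * w u := fun u => by
    simp only [erasure, Fin.snoc_castSucc]
    rw [Finset.sum_eq_single u (fun u' _ h => by simp [h]) (by simp)]
    simp [mul_comm]
  have hl : ∑ u', w u' * erasure m l u' (Fin.last m) = 1 - l := by
    simp only [erasure, Fin.snoc_last]
    rw [← Finset.sum_mul, hw.2, one_mul]
  simp only [entropy, hV, Fin.sum_univ_castSucc, hc, hl, shannon_erasure]
  rw [← Finset.sum_mul, hw.2, one_mul]
  simp only [Real.negMulLog_mul, Finset.sum_add_distrib, ← Finset.mul_sum, ← Finset.sum_mul, hw.2,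
    shannon]
  ring

/-- A mixture of atoms gives an admissible law, the auxiliary `V` being the output of the erasure
channel for which `I(V;U)` is `rate₁`. -/
lemma mem_upperRegion_of_mixture {R : ℝ} (hR : 0 ≤ R)
    (hm : m ≤ Fintype.card A * Fintype.card S * Fintype.card X + 3)
    (hw : w ∈ stdSimplex ℝ (Fin m)) (hν : ∀ u, ν u ∈ stdSimplex ℝ (S × X))
    (hcons : StateConsistent ch (mixture ch w α ν).1)
    (hobs : observationLaw ch (stateInputLaw (mixture ch w α ν).1) = ch.Q₀)
    (hrate : R ≤ mixtureRate ch (mixture ch w α ν)) : R ∈ upperRegion ch := by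
  have hle : mixtureRate ch (mixture ch w α ν) ≤ shannon w := by
    have hκ := erasure_mem (m := m) le_rfl zero_le_one
    rw [← rate₁_mixtureLaw ch hw hν hκ hcons]
    exact rate₁_le_shannon ch hw hν hκ
  -- if `H(U) = 0`, then the rate is `0` as well, and everything is erased
  obtain ⟨l, h0, h1, hl⟩ : ∃ l : ℝ, 0 ≤ l ∧ l ≤ 1 ∧
      l * shannon w = mixtureRate ch (mixture ch w α ν) := by
    rcases (hR.trans (hrate.trans hle)).eq_or_lt with h | h
    · exact ⟨0, le_rfl, zero_le_one, by linarith⟩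
    · exact ⟨mixtureRate ch (mixture ch w α ν) / shannon w,
        div_nonneg (hR.trans hrate) h.le, (div_le_one h).2 hle, div_mul_cancel₀ _ h.ne'⟩
  have hκ := erasure_mem (m := m) h0 h1
  have e1 := rate₁_mixtureLaw ch hw hν hκ hcons
  have e2 := rate₁_le_rate₂ ch (α := α) hw hν hκ
  have e3 := rate₃_erasure ch (α := α) hw hν h0 h1
  have e4 := resolvability_le_rate₃ ch (α := α) hw hν hκ
  refine ⟨hR, m, m + 1, by omega, by nlinarith, mixtureLaw ch w α ν (erasure m l),
    ⟨factorizes_mixtureLaw ch hw hν hκ hcons, by linarith, by linarith, e4, ?_⟩,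
    by linarith, by linarith, by linarith⟩
  rw [law_mixtureLaw_Z ch hκ, hobs]

/-- Carathéodory's theorem in dimension `|A||S||X| + 1` gives `|A||S||X| + 2` atoms. -/
lemma achievable_mem_upperRegion {R : ℝ} (h : CovertAchievable ch R) : R ∈ upperRegion ch := by
  obtain ⟨c, hc, hcons, hobs, hrate⟩ := exists_mixture_of_achievable ch h
  obtain ⟨w, hw, z, hz, rfl⟩ := exists_fin_mixture hc
  choose α ν hν hz using hz
  obtain rfl : z = fun u => (withAction (α u) (ν u), gain ch (ν u)) := funext hz
  refine mem_upperRegion_of_mixture ch h.1 ?_ hw hν hcons hobs hrate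
  rw [Module.finrank_prod, Module.finrank_fintype_fun_eq_card, Module.finrank_self,
    Fintype.card_prod, Fintype.card_prod, ← mul_assoc]
  omega

end Erasure

end CovertADSI

theorem theorem2 {A S X Y Z : Type*}
    [Fintype A] [Fintype S] [Fintype X] [Fintype Y] [Fintype Z]
    (ch : CovertADSI.ActionChannel A S X Y Z) :
    CovertADSI.covertCapacity ch ≤
      ⨆ R ∈ CovertADSI.upperRegion ch, (R : EReal) :=
  iSup₂_mono' fun R hR => ⟨R, CovertADSI.achievable_mem_upperRegion ch hR, le_rfl⟩
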